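/- **Model.** Let $1\le K<M$ be integers, $T=M-K-1$, $P_S,\alpha,\sigma^2>0$, $0\le\mu<1$, $R\ge 0$, and set $$\phi=\frac{P_S\alpha}{\sigma^2},\qquad \omega=\frac{1}{\phi(1-\mu)},\qquad z=2^R-1 .$$ Let $h_0,e_1,\dots,e_M$ be independent circularly symmetric complex Gaussian random variables with law $\mathcal{CN}(0,\alpha)$, and let $$h_m=\sqrt{\mu}\,h_0+\sqrt{1-\mu}\,e_m,\qquad \gamma_0=\frac{P_S|h_0|^2}{\sigma^2},\qquad \gamma_m=\frac{P_S|h_m|^2}{\sigma^2}\qquad(1\le m\le M).$$ Let $\mathbb K\subseteq\{1,\dots,M\}$ be a (random) set of $K$ indices with the $K$ largest values of $\gamma_m$ (ties broken arbitrarily), and let $$P_{\rm out}=\Pr\Big(\log_2\Big(1+\sum_{m\in\mathbb K}\gamma_m\Big)\le R\Big).$$ **Conditional density.** For each $m$, given $\gamma_0=x_0$ (for almost every $x_0$), $\gamma_m$ has on $(0,\infty)$ the density $$f_{x_0}(x)=\omega e^{-\omega(x+\mu x_0)}I_0\big(2\omega\sqrt{\mu x_0x}\big),\qquad I_0(u)=\sum_{k\ge0}\frac{u^{2k}}{2^{2k}\,k!\,\Gamma(k+1)},$$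 and for all $x_0,x\ge0$ $$f_{x_0}(x)=\sum_{k\ge0}\frac{\omega^{2k+1}\mu^k}{(k!)^2}\,x_0^k e^{-\omega\mu x_0}x^ke^{-\omega x}\ \ge\ \bar f_{x_0}(x):=\omega e^{-\omega\mu x_0}e^{-\omega x},$$ where $\bar f_{x_0}(x)$ is the term with $k=0$. **Lower bound.** Let $\bar\Psi(v,x_0)=\int_{[0,v]^T}\prod_{i=1}^{T}\bar f_{x_0}(x_i)\,dx$, let $\bar\Phi(z,v,x_0)$ be the integral of $\prod_{i=1}^K\bar f_{x_0}(x_i)$ over $\{x\in\mathbb R^K: x_i>v \text{ for all } i,\ \sum_i x_i\le z\}$, and let $$\bar P_{\rm out}=\int_0^\infty\int_0^{z/K}\binom MK(T+1)\,\bar\Phi(z,v,x_0)\,\bar\Psi(v,x_0)\,\bar f_{x_0}(v)\,\frac1\phi e^{-x_0/\phi}\,dv\,dx_0 .$$ Then $P_{\rm out}\ge\bar P_{\rm out}$, and $$\bar P_{\rm out}=\binom MK\frac{T+1}{M\mu\omega\phi+1}\left(\sum_{t=0}^T\binom Tt\beta_t-\sum_{t=0}^T\sum_{k=0}^{K-1}\sum_{m=0}^k\binom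 Tt\binom km\kappa_{t,k,m}\right),$$ where, with $\gamma(n,x)=\int_0^xe^{-s}s^{n-1}\,ds$, $$\beta_t=\frac{(-1)^t}{t+K+1}\Big(1-e^{-z\omega(t+K+1)/K}\Big),\qquad \kappa_{t,k,m}=\frac{(-1)^{t+m}K^m(z\omega)^{k-m}e^{-z\omega}\,\gamma\big(m+1,\tfrac{z\omega(t+1)}{K}\big)}{k!\,(t+1)^{m+1}} .$$ -/

import Mathlib

open MeasureTheory ProbabilityTheory

noncomputable section

namespace FAS

/-- The circularly symmetric complex Gaussian law `CN(0, α)`: independent real and imaginary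
parts, each centred Gaussian of variance `α / 2`. -/
def complexGaussian (α : ℝ) : Measure ℂ :=
  ((gaussianReal 0 (α / 2).toNNReal).prod (gaussianReal 0 (α / 2).toNNReal)).map
    Complex.measurableEquivRealProd.symm

/-- The channel parameter of a port, built from the virtual reference port `h₀` and the private
fading `e` with power correlation factor `μ`. -/
def portChannel (μ : ℝ) (h₀ e : ℂ) : ℂ :=
  (Real.sqrt μ : ℂ) * h₀ + (Real.sqrt (1 - μ) : ℂ) * e

/-- Received SNR of a channel parameter `h`, with transmit power `Ps` and noise power `N`. -/
def snr (Ps N : ℝ) (h : ℂ) : ℝ := Ps * ‖h‖ ^ 2 / N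

/-- `S` is a set of `K` ports with the `K` highest values of the SNR `γ` (ties are broken
arbitrarily). -/
def IsBestPorts {M : ℕ} (K : ℕ) (γ : Fin M → ℝ) (S : Finset (Fin M)) : Prop :=
  S.card = K ∧ ∀ i ∈ S, ∀ j ∉ S, γ j ≤ γ i

/-- Modified Bessel function of the first kind of order `0`. -/
def besselI0 (u : ℝ) : ℝ :=
  ∑' k : ℕ, u ^ (2 * k) / (2 ^ (2 * k) * (k.factorial : ℝ) * Real.Gamma (k + 1))

/-- Conditional density at `x` of the SNR of a port given that the reference SNR is `x₀`
(for `x ≥ 0`). -/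
def condDensity (ω μ x₀ x : ℝ) : ℝ :=
  ω * Real.exp (-ω * (x + μ * x₀)) * besselI0 (2 * ω * Real.sqrt (μ * x₀ * x))

/-- The `k`-th term of the series expansion of the conditional density. -/
def condDensityTerm (ω μ : ℝ) (k : ℕ) (x₀ x : ℝ) : ℝ :=
  ω ^ (2 * k + 1) * μ ^ k / (k.factorial : ℝ) ^ 2 *
    x₀ ^ k * Real.exp (-ω * μ * x₀) * x ^ k * Real.exp (-ω * x)

/-- The lower bound of the conditional density. -/
def lowerDensity (ω μ x₀ x : ℝ) : ℝ :=
  ω * Real.exp (-ω * μ * x₀) * Real.exp (-ω * x)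

/-- `Ψ(v, x₀)` with the conditional density replaced by its lower bound: the integral of the
product density of `T` ports over `[0, v]^T`. -/
def lowerPsi (ω μ : ℝ) (T : ℕ) (v x₀ : ℝ) : ℝ :=
  ∫ x in {x : Fin T → ℝ | ∀ i, 0 ≤ x i ∧ x i ≤ v}, ∏ i, lowerDensity ω μ x₀ (x i)

/-- `Φ(z, v, x₀)` with the conditional density replaced by its lower bound: the integral of the
product density of `K` ports over the points whose coordinates exceed `v` and sum to at
most `z`. -/
def lowerPhi (ω μ : ℝ) (K : ℕ) (z v x₀ : ℝ) : ℝ :=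
  ∫ x in {x : Fin K → ℝ | (∀ i, v < x i) ∧ ∑ i, x i ≤ z}, ∏ i, lowerDensity ω μ x₀ (x i)

/-- The lower bound of the outage probability: the exact double integral for the outage
probability, over the reference SNR `x₀` and the `(K+1)`-th largest port SNR `v`, in which every
conditional density is replaced by its lower bound. -/
def lowerOutage (M K : ℕ) (φ ω μ z : ℝ) : ℝ :=
  ∫ x₀ in Set.Ioi (0 : ℝ), ∫ v in (0 : ℝ)..(z / K),
    (M.choose K : ℝ) * (((M - K - 1 : ℕ) : ℝ) + 1) *
      lowerPhi ω μ K z v x₀ * lowerPsi ω μ (M - K - 1) v x₀ * lowerDensity ω μ x₀ v *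
        (1 / φ * Real.exp (-x₀ / φ))

/-- Lower incomplete Gamma function `γ(κ, x)` at a positive integer `κ`. -/
def lowerGamma (κ : ℕ) (x : ℝ) : ℝ :=
  ∫ t in (0 : ℝ)..x, Real.exp (-t) * t ^ (κ - 1)

def betaCoeff (K : ℕ) (ω z : ℝ) (t : ℕ) : ℝ :=
  (-1) ^ t / ((t : ℝ) + K + 1) * (1 - Real.exp (-(z * ω * ((t : ℝ) + K + 1) / K)))

def kappaCoeff (K : ℕ) (ω z : ℝ) (t k m : ℕ) : ℝ :=
  (-1) ^ (t + m) * (K : ℝ) ^ m * (z * ω) ^ (k - m) * Real.exp (-(z * ω)) *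
    lowerGamma (m + 1) (z * ω * ((t : ℝ) + 1) / K) / ((k.factorial : ℝ) * ((t : ℝ) + 1) ^ (m + 1))

/-- The closed form of the lower bound, with `T = M - K - 1`. -/
def lowerOutageClosed (M K : ℕ) (φ ω μ z : ℝ) : ℝ :=
  (M.choose K : ℝ) * ((((M - K - 1 : ℕ) : ℝ) + 1) / (M * μ * ω * φ + 1)) *
    (∑ t ∈ Finset.range (M - K - 1 + 1), ((M - K - 1).choose t : ℝ) * betaCoeff K ω z t -
      ∑ t ∈ Finset.range (M - K - 1 + 1), ∑ k ∈ Finset.range K, ∑ m ∈ Finset.range (k + 1),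
        ((M - K - 1).choose t : ℝ) * (k.choose m : ℝ) * kappaCoeff K ω z t k m)

end FAS

end

noncomputable section

namespace FAS

/-! Given `h₀`, the port SNRs are i.i.d.: each is a multiple of the squared modulus of a planar
Gaussian with mean `√μ h₀`, and polar coordinates turn the angular integral into `I₀`
(`lintegral_norm_sq_gaussian`, `map_snr_portChannel`). All terms of the series of this density are
nonnegative, and the term of index zero is `exp (-ωμx₀)` times the exponential density of rate `ω`.

The bound is thus a domination of measures. Given reference SNR `x₀`, the joint law of the `M` SNRs
is at least `exp (-ωμx₀) ^ M` times a product of exponential laws. Since `x₀` is exponential of mean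
`φ`, averaging leaves the constant `1 / (Mμωφ + 1)` (`le_measure_snr_mem`). The outage event
contains the disjoint regions indexed by a set `S` of `K` ports and a port `j ∉ S`, where `S` lies
strictly above `j`, `j` strictly above the rest, and the sum over `S` is at most `z`. There are
`choose M K * (M - K)` of them, all of the same exponential measure `orderIntegral`
(`pi_expLaw_orderRegion`).

The double integral `lowerOutage` factors into the same constants. For the closed form,
memorylessness gives the inner integral as an Erlang distribution function
(`pi_expLaw_tailSimplex`), and two binomial expansions finish (`orderIntegral_eq`). -/

/-! ### The Bessel function `I₀`: series and circle integrals. -/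

lemma besselI0_term (u : ℝ) (k : ℕ) :
    u ^ (2 * k) / (2 ^ (2 * k) * (k.factorial : ℝ) * Real.Gamma (k + 1)) =
      (u ^ 2 / 4) ^ k / (k.factorial : ℝ) ^ 2 := by
  rw [Real.Gamma_nat_eq_factorial, pow_mul, pow_mul, div_pow]
  norm_num
  field_simp

lemma hasSum_besselI0 (u : ℝ) :
    HasSum (fun k : ℕ => (u ^ 2 / 4) ^ k / (k.factorial : ℝ) ^ 2) (besselI0 u) := by
  have hs : Summable (fun k : ℕ => (u ^ 2 / 4) ^ k / (k.factorial : ℝ) ^ 2) := by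
    refine Summable.of_nonneg_of_le (fun k => by positivity) (fun k => ?_)
      (Real.summable_pow_div_factorial (u ^ 2 / 4))
    have h1 : (1 : ℝ) ≤ k.factorial := by
      exact_mod_cast Nat.one_le_iff_ne_zero.2 k.factorial_ne_zero
    gcongr
    nlinarith
  have := hs.hasSum
  unfold besselI0
  simp_rw [besselI0_term]
  exact this

lemma integral_cos_pow_add_two (n : ℕ) :
    ∫ θ in -Real.pi..Real.pi, Real.cos θ ^ (n + 2) =
      (n + 1) / (n + 2) * ∫ θ in -Real.pi..Real.pi, Real.cos θ ^ n := by
  rw [integral_cos_pow]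
  simp

lemma integral_cos_pow_odd (k : ℕ) :
    ∫ θ in -Real.pi..Real.pi, Real.cos θ ^ (2 * k + 1) = 0 := by
  induction k with
  | zero => simp
  | succ k ih =>
    rw [show 2 * (k + 1) + 1 = 2 * k + 1 + 2 by ring, integral_cos_pow_add_two, ih, mul_zero]

lemma integral_cos_pow_even (k : ℕ) :
    ∫ θ in -Real.pi..Real.pi, Real.cos θ ^ (2 * k) =
      2 * Real.pi * ((2 * k).factorial / (4 ^ k * (k.factorial : ℝ) ^ 2)) := by
  induction k with
  | zero => simp; ring
  | succ k ih =>
    rw [show 2 * (k + 1) = 2 * k + 2 by ring, integral_cos_pow_add_two, ih,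
      Nat.factorial_succ (2 * k + 1), Nat.factorial_succ (2 * k), Nat.factorial_succ k]
    push_cast
    field_simp
    ring

/-- Integrate the exponential series term by term, dominated by `|u| ^ n / n!`. Odd powers of the
cosine integrate to zero, and the Wallis values of the even ones give the Bessel coefficients. -/
lemma integral_exp_mul_cos (u : ℝ) :
    ∫ θ in -Real.pi..Real.pi, Real.exp (u * Real.cos θ) = 2 * Real.pi * besselI0 u := by
  have h1 : HasSum (fun n : ℕ => ∫ θ in -Real.pi..Real.pi, (u * Real.cos θ) ^ n / n.factorial)
      (∫ θ in -Real.pi..Real.pi, Real.exp (u * Real.cos θ)) := by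
    refine intervalIntegral.hasSum_integral_of_dominated_convergence
      (fun n _ => |u| ^ n / n.factorial) (fun n => ?_) (fun n => ?_) ?_ ?_ ?_
    · exact (by fun_prop : Continuous fun θ : ℝ =>
        (u * Real.cos θ) ^ n / (n.factorial : ℝ)).aestronglyMeasurable
    · refine Filter.Eventually.of_forall fun θ _ => ?_
      rw [norm_div, norm_pow, norm_mul, Real.norm_eq_abs, Real.norm_eq_abs, Real.norm_natCast]
      gcongr
      exact mul_le_of_le_one_right (abs_nonneg _) (Real.abs_cos_le_one θ)
    · exact Filter.Eventually.of_forall fun θ _ => Real.summable_pow_div_factorial _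
    · exact intervalIntegrable_const
    · refine Filter.Eventually.of_forall fun θ _ => ?_
      rw [Real.exp_eq_exp_ℝ]
      exact NormedSpace.expSeries_div_hasSum_exp (u * Real.cos θ)
  have h2 := (hasSum_besselI0 u).mul_left (2 * Real.pi)
  have hinj : Function.Injective (fun k : ℕ => 2 * k) := fun a b h => by simpa using h
  refine h1.unique ((hinj.hasSum_iff fun n hn => ?_).1 ?_)
  · have : ¬ Even n := fun ⟨k, hk⟩ => hn ⟨k, by simp; omega⟩
    obtain ⟨k, rfl⟩ := Nat.not_even_iff_odd.1 this
    simp_rw [mul_pow]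
    rw [intervalIntegral.integral_div, intervalIntegral.integral_const_mul, integral_cos_pow_odd]
    simp
  · refine (congrArg (HasSum · _) (funext fun k => ?_)).mpr h2
    simp only [Function.comp_apply, mul_pow]
    rw [intervalIntegral.integral_div, intervalIntegral.integral_const_mul, integral_cos_pow_even,
      div_pow, pow_mul]
    have : ((2 * k).factorial : ℝ) ≠ 0 := by exact_mod_cast (2 * k).factorial_ne_zero
    field_simp

/-- The exponent is `‖c‖ cos (θ - arg c)` with `c = a + bi`, and by periodicity the shift does not
change the integral. -/
lemma integral_exp_cos_add_sin (a b : ℝ) :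
    ∫ θ in -Real.pi..Real.pi, Real.exp (a * Real.cos θ + b * Real.sin θ) =
      2 * Real.pi * besselI0 (Real.sqrt (a ^ 2 + b ^ 2)) := by
  set c : ℂ := ⟨a, b⟩ with hc
  have hn : Real.sqrt (a ^ 2 + b ^ 2) = ‖c‖ := by
    rw [Complex.norm_eq_sqrt_sq_add_sq]
  have h : ∀ θ : ℝ, a * Real.cos θ + b * Real.sin θ = ‖c‖ * Real.cos (θ - c.arg) := by
    intro θ
    have h1 : a = ‖c‖ * Real.cos c.arg := (Complex.norm_mul_cos_arg c).symm
    have h2 : b = ‖c‖ * Real.sin c.arg := (Complex.norm_mul_sin_arg c).symm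
    rw [Real.cos_sub, mul_add]
    conv_lhs => rw [h1, h2]
    ring
  simp_rw [h]
  rw [hn, ← integral_exp_mul_cos,
    intervalIntegral.integral_comp_sub_right (fun θ => Real.exp (‖c‖ * Real.cos θ))]
  have hp : Function.Periodic (fun θ => Real.exp (‖c‖ * Real.cos θ)) (2 * Real.pi) := fun θ => by
    simp
  have := hp.intervalIntegral_add_eq (-Real.pi - c.arg) (-Real.pi)
  convert this using 2 <;> ring

/-! ### The conditional density, its series and its lower bound. -/

lemma hasSum_condDensityTerm {ω μ x₀ x : ℝ} (hμ : 0 ≤ μ) (hx₀ : 0 ≤ x₀) (hx : 0 ≤ x) :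
    HasSum (fun k => condDensityTerm ω μ k x₀ x) (condDensity ω μ x₀ x) := by
  have h := (hasSum_besselI0 (2 * ω * Real.sqrt (μ * x₀ * x))).mul_left
    (ω * Real.exp (-ω * (x + μ * x₀)))
  unfold condDensity
  refine (congrArg (HasSum · _) (funext fun k => ?_)).mpr h
  rw [mul_pow, mul_pow, Real.sq_sqrt (by positivity), condDensityTerm, div_pow,
    show -ω * (x + μ * x₀) = -ω * μ * x₀ + -ω * x by ring, Real.exp_add]
  rw [show ((2:ℝ) ^ 2 * ω ^ 2 * (μ * x₀ * x)) ^ k / 4 ^ k = ω ^ (2 * k) * (μ ^ k * x₀ ^ k * x ^ k) by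
    rw [pow_mul, mul_pow, mul_pow, mul_pow, mul_pow]; norm_num; field_simp]
  ring

lemma lowerDensity_eq_term (ω μ x₀ x : ℝ) :
    lowerDensity ω μ x₀ x = condDensityTerm ω μ 0 x₀ x := by
  simp [lowerDensity, condDensityTerm]

lemma lowerDensity_le_condDensity {ω μ x₀ x : ℝ} (hω : 0 ≤ ω) (hμ : 0 ≤ μ) (hx₀ : 0 ≤ x₀)
    (hx : 0 ≤ x) : lowerDensity ω μ x₀ x ≤ condDensity ω μ x₀ x := by
  rw [lowerDensity_eq_term]
  refine le_hasSum (hasSum_condDensityTerm hμ hx₀ hx) 0 fun k _ => ?_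
  unfold condDensityTerm
  positivity

lemma measurable_besselI0 : Measurable besselI0 := by
  -- The circle integral depends continuously on its parameter, which gives measurability without
  -- working with the series.
  have h : besselI0 = fun u => (∫ θ in -Real.pi..Real.pi, Real.exp (u * Real.cos θ)) /
      (2 * Real.pi) := by
    ext u
    rw [integral_exp_mul_cos, mul_div_cancel_left₀ _ (by positivity)]
  rw [h]
  exact ((intervalIntegral.continuous_parametric_intervalIntegral_of_continuous' (by fun_prop)
    _ _).div_const _).measurable

lemma measurable_condDensity (ω μ x₀ : ℝ) : Measurable (condDensity ω μ x₀) := by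
  unfold condDensity
  have := measurable_besselI0
  fun_prop

/-! ### Exponential laws and sums of exponential variables. -/

/-- The exponential law of rate `ω`, as a density with respect to Lebesgue measure on `(0, ∞)`. -/
def expLaw (ω : ℝ) : Measure ℝ :=
  (volume.restrict (Set.Ioi (0 : ℝ))).withDensity fun x => ENNReal.ofReal (ω * Real.exp (-ω * x))

/-- The distribution function of a sum of `K` independent standard exponential variables. -/
def erlang (K : ℕ) (u : ℝ) : ℝ :=
  1 - Real.exp (-u) * ∑ k ∈ Finset.range K, u ^ k / (k.factorial : ℝ)

lemma erlang_nonneg (K : ℕ) {u : ℝ} (hu : 0 ≤ u) : 0 ≤ erlang K u := by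
  have h := Real.sum_le_exp_of_nonneg hu K
  have : Real.exp (-u) * ∑ k ∈ Finset.range K, u ^ k / (k.factorial : ℝ) ≤
      Real.exp (-u) * Real.exp u := by gcongr
  rw [← Real.exp_add, neg_add_cancel, Real.exp_zero] at this
  unfold erlang
  linarith

lemma erlang_succ_zero (K : ℕ) : erlang (K + 1) 0 = 0 := by
  simp [erlang, Finset.sum_range_succ']

@[fun_prop]
lemma continuous_erlang (K : ℕ) : Continuous (erlang K) := by
  unfold erlang
  fun_prop

lemma erlang_succ (K : ℕ) (u : ℝ) :
    erlang (K + 1) u = erlang K u - Real.exp (-u) * (u ^ K / K.factorial) := by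
  simp only [erlang, Finset.sum_range_succ]
  ring

/-- With `erlang_succ` this yields `E_{K+1} + E_{K+1}' = E_K`, the relation behind
`integral_erlang`. -/
lemma hasDerivAt_erlang_succ (K : ℕ) (u : ℝ) :
    HasDerivAt (erlang (K + 1)) (Real.exp (-u) * (u ^ K / K.factorial)) u := by
  have hexp : HasDerivAt (fun u : ℝ => Real.exp (-u)) (-Real.exp (-u)) u := by
    simpa using (hasDerivAt_neg u).exp
  induction K with
  | zero =>
    have h : erlang (0 + 1) = fun u => 1 - Real.exp (-u) := by
      ext u
      simp [erlang]
    rw [h]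
    simpa using hexp.const_sub 1
  | succ K ih =>
    have h : erlang (K + 1 + 1) = fun u => erlang (K + 1) u -
        Real.exp (-u) * (u ^ (K + 1) / (K + 1).factorial) := by
      ext u
      exact erlang_succ _ _
    rw [h]
    convert! ih.sub (hexp.mul ((hasDerivAt_pow (K + 1) u).div_const ((K + 1).factorial : ℝ))) using 1
    rw [Nat.factorial_succ]
    push_cast
    have : (K.factorial : ℝ) ≠ 0 := by exact_mod_cast K.factorial_ne_zero
    field_simp
    ring

lemma integrable_exp_Ioi {ω : ℝ} (hω : 0 < ω) :
    Integrable (fun x => ω * Real.exp (-ω * x)) (volume.restrict (Set.Ioi (0 : ℝ))) :=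
  (exp_neg_integrableOn_Ioi 0 hω).const_mul ω

lemma isProbabilityMeasure_expLaw {ω : ℝ} (hω : 0 < ω) : IsProbabilityMeasure (expLaw ω) := by
  constructor
  rw [expLaw, withDensity_apply _ MeasurableSet.univ, Measure.restrict_univ,
    ← ofReal_integral_eq_lintegral_ofReal (integrable_exp_Ioi hω)
      (Filter.Eventually.of_forall fun x => by positivity), integral_const_mul,
    integral_exp_mul_Ioi (by linarith)]
  simp [hω.ne']

lemma lintegral_expLaw (ω : ℝ) (f : ℝ → ENNReal) :
    ∫⁻ x, f x ∂(expLaw ω) =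
      ∫⁻ x in Set.Ioi 0, ENNReal.ofReal (ω * Real.exp (-ω * x)) * f x := by
  rw [expLaw, lintegral_withDensity_eq_lintegral_mul_non_measurable _ (by fun_prop)]
  · rfl
  · exact Filter.Eventually.of_forall fun x => ENNReal.ofReal_lt_top

lemma integral_exp_neg_mul {ω : ℝ} (v : ℝ) :
    ∫ x in (0 : ℝ)..v, ω * Real.exp (-ω * x) = 1 - Real.exp (-ω * v) := by
  rw [intervalIntegral.integral_eq_sub_of_hasDerivAt
    (f := fun x => -Real.exp (-ω * x)) (fun x _ => ?_)
    (Continuous.intervalIntegrable (by fun_prop) _ _)]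
  · simp; ring
  · have := (((hasDerivAt_id x).const_mul (-ω)).exp).neg
    simp only [id] at this
    convert! this using 1
    ring

lemma lintegral_ofReal_Ioc {a b : ℝ} (hab : a ≤ b) {f : ℝ → ℝ} (hf : Continuous f)
    (h0 : ∀ x ∈ Set.Ioc a b, 0 ≤ f x) :
    ∫⁻ x in Set.Ioc a b, ENNReal.ofReal (f x) = ENNReal.ofReal (∫ x in a..b, f x) := by
  rw [intervalIntegral.integral_of_le hab, ofReal_integral_eq_lintegral_ofReal]
  · exact (hf.integrableOn_Icc).mono_set Set.Ioc_subset_Icc_self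
  · exact (ae_restrict_iff' measurableSet_Ioc).2 (Filter.Eventually.of_forall h0)

lemma expLaw_Iio {ω : ℝ} (hω : 0 < ω) {v : ℝ} (hv : 0 ≤ v) :
    expLaw ω (Set.Iio v) = ENNReal.ofReal (1 - Real.exp (-ω * v)) := by
  rw [expLaw, withDensity_apply _ measurableSet_Iio, Measure.restrict_restrict measurableSet_Iio,
    Set.inter_comm, Set.Ioi_inter_Iio, Measure.restrict_congr_set Ioo_ae_eq_Ioc,
    lintegral_ofReal_Ioc hv (by fun_prop) (fun x _ => by positivity), integral_exp_neg_mul]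

/-- Lets the probability of a region under independent exponentials be read as a Lebesgue integral
of a product density, the form used by `lowerPhi`. -/
lemma pi_expLaw {ι : Type*} [Fintype ι] {ω : ℝ} (hω : 0 < ω) :
    Measure.pi (fun _ : ι => expLaw ω) =
      (volume.restrict (Set.univ.pi fun _ : ι => Set.Ioi (0 : ℝ))).withDensity
        fun x => ENNReal.ofReal (∏ i, ω * Real.exp (-ω * x i)) := by
  have := isProbabilityMeasure_expLaw hω
  refine Measure.pi_eq fun s hs => ?_
  rw [withDensity_apply _ (MeasurableSet.univ_pi hs), volume_pi, Measure.restrict_pi_pi,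
    Measure.restrict_pi_pi, ← ofReal_integral_eq_lintegral_ofReal]
  · rw [integral_fintype_prod_eq_prod (fun _ x => ω * Real.exp (-ω * x)),
      ENNReal.ofReal_prod_of_nonneg (fun i _ => integral_nonneg fun x => by positivity)]
    refine Finset.prod_congr rfl fun i _ => ?_
    rw [expLaw, withDensity_apply _ (hs i), ofReal_integral_eq_lintegral_ofReal]
    · exact (integrable_exp_Ioi hω).restrict
    · exact Filter.Eventually.of_forall fun x => by positivity
  · exact Integrable.fintype_prod (f := fun _ x => ω * Real.exp (-ω * x))
      fun i => (integrable_exp_Ioi hω).restrict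
  · exact Filter.Eventually.of_forall fun x => Finset.prod_nonneg fun i _ => by positivity

/-- The points whose coordinates all exceed `v` and sum to at most `z`. -/
def tailSimplex (K : ℕ) (v z : ℝ) : Set (Fin K → ℝ) := {x | (∀ i, v < x i) ∧ ∑ i, x i ≤ z}

lemma measurableSet_tailSimplex (K : ℕ) (v z : ℝ) : MeasurableSet (tailSimplex K v z) := by
  unfold tailSimplex
  measurability

lemma tailSimplex_eq_empty {K : ℕ} {v z : ℝ} (hK : 1 ≤ K) (h : z ≤ K * v) :
    tailSimplex K v z = ∅ := by
  ext x
  simp only [tailSimplex, Set.mem_ofPred_eq, Set.mem_empty_iff_false, iff_false, not_and, not_le]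
  intro hx
  refine h.trans_lt ?_
  have : ∑ i : Fin K, v < ∑ i, x i :=
    Finset.sum_lt_sum_of_nonempty ⟨⟨0, hK⟩, Finset.mem_univ _⟩ fun i _ => hx i
  simpa using this

/-- The convolution step that adds one variable. Since `E_{K+1} + E_{K+1}' = E_K`, an antiderivative
is a multiple of `exp (-ωx) * E_{K+1}`; it vanishes at the upper endpoint because `E_{K+1} 0 = 0`.
-/
lemma integral_erlang (K : ℕ) (ω v s : ℝ) :
    ∫ x in v..(s - K * v), ω * Real.exp (-ω * x) *
        (Real.exp (-(K * ω * v)) * erlang K (ω * (s - x - K * v))) =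
      Real.exp (-((K + 1 : ℕ) * ω * v)) * erlang (K + 1) (ω * (s - (K + 1 : ℕ) * v)) := by
  rw [intervalIntegral.integral_eq_sub_of_hasDerivAt
    (f := fun x => -(Real.exp (-(K * ω * v)) *
      (Real.exp (-ω * x) * erlang (K + 1) (ω * (s - x - K * v))))) (fun x _ => ?_)
    (Continuous.intervalIntegrable (by fun_prop) _ _)]
  · rw [show ω * (s - (s - K * v) - K * v) = 0 by ring, erlang_succ_zero,
      show -(((K + 1 : ℕ) : ℝ) * ω * v) = -(K * ω * v) + -ω * v by push_cast; ring, Real.exp_add,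
      show s - ((K + 1 : ℕ) : ℝ) * v = s - v - K * v by push_cast; ring]
    ring
  · have h1 : HasDerivAt (fun x => Real.exp (-ω * x)) (Real.exp (-ω * x) * (-ω)) x := by
      simpa using ((hasDerivAt_id x).const_mul (-ω)).exp
    have h2 : HasDerivAt (fun x => ω * (s - x - K * v)) (-ω) x := by
      simpa using (((hasDerivAt_id x).const_sub s).sub_const (K * v)).const_mul ω
    have h3 := (hasDerivAt_erlang_succ K (ω * (s - x - K * v))).comp x h2
    convert! ((h1.mul h3).const_mul (Real.exp (-(K * ω * v)))).neg using 1
    rw [Function.comp_apply, erlang_succ]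
    ring

/-- Memorylessness: all `K` variables exceed `v` with probability `exp (-Kωv)`, and the excesses are
again i.i.d. exponential, with sum at most `s - K * v`. The proof is an induction that splits off
one coordinate. -/
lemma pi_expLaw_tailSimplex {ω : ℝ} (hω : 0 < ω) {v : ℝ} (hv : 0 ≤ v) (K : ℕ) :
    ∀ s : ℝ, K * v ≤ s → Measure.pi (fun _ : Fin K => expLaw ω) (tailSimplex K v s) =
      ENNReal.ofReal (Real.exp (-(K * ω * v)) * erlang K (ω * (s - K * v))) := by
  have := isProbabilityMeasure_expLaw hω
  induction K with
  | zero =>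
    intro s hs
    have : tailSimplex 0 v s = Set.univ := by
      ext x
      simpa [tailSimplex] using hs
    simp [this, erlang]
  | succ K ih =>
    intro s hs
    have hs' : v ≤ s - K * v := by push_cast at hs; linarith
    have mp := (measurePreserving_piFinSuccAbove (fun _ : Fin (K + 1) => expLaw ω) 0).symm
    rw [← mp.measure_preimage_equiv, Measure.prod_apply
      (mp.measurable (measurableSet_tailSimplex _ _ _)), lintegral_expLaw]
    have key : ∀ x : ℝ, Measure.pi (fun _ : Fin K => expLaw ω) (Prod.mk x ⁻¹'
        ((MeasurableEquiv.piFinSuccAbove (fun _ => ℝ) (0 : Fin (K + 1))).symm ⁻¹'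
          tailSimplex (K + 1) v s)) = (Set.Ioc v (s - K * v)).indicator (fun x => ENNReal.ofReal
            (Real.exp (-(K * ω * v)) * erlang K (ω * (s - x - K * v)))) x := by
      intro x
      have hset : Prod.mk x ⁻¹' ((MeasurableEquiv.piFinSuccAbove (fun _ => ℝ)
          (0 : Fin (K + 1))).symm ⁻¹' tailSimplex (K + 1) v s) =
          {y | v < x ∧ y ∈ tailSimplex K v (s - x)} := by
        ext y
        simp only [tailSimplex, Set.mem_preimage, Set.mem_ofPred_eq,
          MeasurableEquiv.piFinSuccAbove_symm_apply, Fin.insertNthEquiv, Equiv.coe_fn_mk,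
          Fin.insertNth_zero, Fin.forall_fin_succ, Fin.sum_univ_succ, Fin.cons_zero, Fin.cons_succ,
          and_assoc]
        rw [le_sub_iff_add_le']
        rfl
      rw [hset]
      by_cases hx : x ∈ Set.Ioc v (s - K * v)
      · rw [Set.indicator_of_mem hx, ← ih (s - x) (by linarith [hx.2])]
        simp [hx.1]
      · rw [Set.indicator_of_notMem hx]
        by_cases hvx : v < x
        · have h1 : s - x < K * v := by
            by_contra h
            exact hx ⟨hvx, by linarith⟩
          have h2 : tailSimplex K v (s - x) = ∅ := by
            -- With no coordinate left the strict bounds are vacuous, and emptiness comes from the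
            -- empty sum exceeding the negative number `s - x`.
            rcases Nat.eq_zero_or_pos K with rfl | hK
            · ext y
              simp [tailSimplex] at h1 ⊢
              exact h1
            · exact tailSimplex_eq_empty hK h1.le
          simp [h2]
        · simp [hvx]
    simp_rw [key]
    rw [← integral_erlang, ← lintegral_ofReal_Ioc hs' (by fun_prop)]
    · have hsub : Set.Ioc v (s - K * v) ⊆ Set.Ioi 0 := fun x hx => hv.trans_lt hx.1
      rw [← Set.inter_eq_left.2 hsub, ← Measure.restrict_restrict measurableSet_Ioc,
        ← lintegral_indicator measurableSet_Ioc]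
      refine lintegral_congr fun x => ?_
      by_cases hx : x ∈ Set.Ioc v (s - K * v)
      · simp only [Set.inter_eq_left.2 hsub, Set.indicator_of_mem hx]
        rw [← ENNReal.ofReal_mul (by positivity)]
      · simp only [Set.inter_eq_left.2 hsub, Set.indicator_of_notMem hx, mul_zero]
    · intro x hx
      have := erlang_nonneg K (u := ω * (s - x - K * v)) (mul_nonneg hω.le (by linarith [hx.2]))
      positivity

/-! ### The order-statistic integral and its closed form. -/

/-- The probability, for `K + T + 1` independent exponential variables of rate `ω`, that the last
one is exceeded by the first `K`, which sum to at most `z`, and exceeds the others. -/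
def orderIntegral (K T : ℕ) (ω z : ℝ) : ℝ :=
  ∫ v in (0 : ℝ)..(z / K), ω * Real.exp (-ω * v) *
    (Real.exp (-(K * ω * v)) * erlang K (ω * (z - K * v)) * (1 - Real.exp (-ω * v)) ^ T)

lemma one_sub_exp_nonneg {ω v : ℝ} (hω : 0 ≤ ω) (hv : 0 ≤ v) : 0 ≤ 1 - Real.exp (-ω * v) := by
  rw [sub_nonneg, Real.exp_le_one_iff]
  nlinarith

/-- For `v > z / K`, `K` coordinates above `v` cannot sum to at most `z`, so only `v ≤ z / K`
contributes. -/
lemma lintegral_order {ω : ℝ} (hω : 0 < ω) {K T : ℕ} (hK : 1 ≤ K) {z : ℝ} (hz : 0 ≤ z) :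
    ∫⁻ v, Measure.pi (fun _ : Fin K => expLaw ω) (tailSimplex K v z) * expLaw ω (Set.Iio v) ^ T
      ∂(expLaw ω) = ENNReal.ofReal (orderIntegral K T ω z) := by
  have hK' : (0 : ℝ) < K := by exact_mod_cast hK
  have hz' : 0 ≤ z / K := by positivity
  rw [lintegral_expLaw, orderIntegral, ← lintegral_ofReal_Ioc hz' (by fun_prop)]
  · have hsub : Set.Ioc 0 (z / K) ⊆ Set.Ioi 0 := fun x hx => hx.1
    rw [← Set.inter_eq_left.2 hsub, ← Measure.restrict_restrict measurableSet_Ioc,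
      ← lintegral_indicator measurableSet_Ioc]
    refine setLIntegral_congr_fun measurableSet_Ioi fun v hv => ?_
    have hv : 0 < v := hv
    by_cases h : v ≤ z / K
    · have h' : K * v ≤ z := by rwa [le_div_iff₀' hK'] at h
      have he := erlang_nonneg K (u := ω * (z - K * v)) (mul_nonneg hω.le (by linarith))
      rw [Set.indicator_of_mem (show v ∈ Set.Ioc 0 (z / K) from ⟨hv, h⟩)]
      rw [pi_expLaw_tailSimplex hω hv.le K z h', expLaw_Iio hω hv.le,
        ← ENNReal.ofReal_pow (one_sub_exp_nonneg hω.le hv.le),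
        ← ENNReal.ofReal_mul (by positivity), ← ENNReal.ofReal_mul (by positivity)]
    · rw [Set.indicator_of_notMem (fun h1 => h h1.2), tailSimplex_eq_empty hK]
      · simp
      · rw [not_le, div_lt_iff₀' hK'] at h
        exact h.le
  · intro v hv
    have h' : K * v ≤ z := by
      have := hv.2
      rwa [le_div_iff₀' hK'] at this
    have he := erlang_nonneg K (u := ω * (z - K * v)) (mul_nonneg hω.le (by linarith))
    have := one_sub_exp_nonneg hω.le hv.1.le
    positivity

lemma integral_exp_neg_scaled {ω c : ℝ} (hc : c ≠ 0) (v : ℝ) :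
    ∫ x in (0 : ℝ)..v, ω * Real.exp (-(c * ω * x)) = (1 - Real.exp (-(c * ω * v))) / c := by
  have h := integral_exp_neg_mul (ω := c * ω) v
  simp only [neg_mul] at h
  rw [← h, eq_div_iff hc, mul_comm, ← intervalIntegral.integral_const_mul]
  simp only [mul_assoc]

lemma integral_pow_mul_exp_neg {ω c : ℝ} (hc : c ≠ 0) (m : ℕ) (v : ℝ) :
    ∫ x in (0 : ℝ)..v, ω * ((ω * x) ^ m * Real.exp (-(c * ω * x))) =
      lowerGamma (m + 1) (c * ω * v) / c ^ (m + 1) := by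
  have h := intervalIntegral.smul_integral_comp_mul_left (a := 0) (b := v)
    (fun s => Real.exp (-s) * s ^ m) (c * ω)
  rw [mul_zero] at h
  rw [lowerGamma, Nat.add_sub_cancel, ← h, eq_div_iff (by positivity), smul_eq_mul, mul_comm,
    ← intervalIntegral.integral_const_mul, ← intervalIntegral.integral_const_mul]
  congr 1
  ext x
  ring

lemma one_sub_pow_expand (T : ℕ) (y : ℝ) :
    (1 - y) ^ T = ∑ t ∈ Finset.range (T + 1), (T.choose t : ℝ) * ((-1) ^ t * y ^ t) := by
  rw [sub_eq_neg_add, add_pow]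
  refine Finset.sum_congr rfl fun t _ => ?_
  rw [neg_pow, one_pow]
  ring

/-- Expand `(1 - exp (-ωv)) ^ T` binomially. The `1` in the Erlang function produces the `betaCoeff`
terms; in its sum, `(ω (z - K v)) ^ k` is expanded again and each power of `ωv` integrates to an
incomplete Gamma value in `kappaCoeff`. -/
lemma orderIntegral_eq {K : ℕ} (hK : 1 ≤ K) (T : ℕ) (ω z : ℝ) :
    orderIntegral K T ω z =
      ∑ t ∈ Finset.range (T + 1), (T.choose t : ℝ) * betaCoeff K ω z t -
      ∑ t ∈ Finset.range (T + 1), ∑ k ∈ Finset.range K, ∑ m ∈ Finset.range (k + 1),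
        (T.choose t : ℝ) * (k.choose m : ℝ) * kappaCoeff K ω z t k m := by
  have hK' : (K : ℝ) ≠ 0 := by positivity
  have hβ : ∀ t : ℕ, (T.choose t : ℝ) * betaCoeff K ω z t = ∫ v in (0 : ℝ)..(z / K),
      (T.choose t : ℝ) * (-1) ^ t * (ω * Real.exp (-(((t : ℝ) + K + 1) * ω * v))) := by
    intro t
    rw [intervalIntegral.integral_const_mul, integral_exp_neg_scaled (by positivity), betaCoeff]
    rw [show z * ω * ((t : ℝ) + K + 1) / K = ((t : ℝ) + K + 1) * ω * (z / K) by ring]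
    ring
  have hκ : ∀ t k m : ℕ, (T.choose t : ℝ) * (k.choose m : ℝ) * kappaCoeff K ω z t k m =
      ∫ v in (0 : ℝ)..(z / K), (T.choose t : ℝ) * (k.choose m : ℝ) *
        ((-1) ^ (t + m) * (K : ℝ) ^ m * (z * ω) ^ (k - m) * Real.exp (-(z * ω)) /
          (k.factorial : ℝ)) * (ω * ((ω * v) ^ m * Real.exp (-(((t : ℝ) + 1) * ω * v)))) := by
    intro t k m
    rw [intervalIntegral.integral_const_mul, integral_pow_mul_exp_neg (by positivity), kappaCoeff]
    rw [show z * ω * ((t : ℝ) + 1) / K = ((t : ℝ) + 1) * ω * (z / K) by ring]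
    have : (k.factorial : ℝ) ≠ 0 := by exact_mod_cast k.factorial_ne_zero
    field_simp
  simp_rw [hβ, hκ]
  have hint : ∀ f : ℝ → ℝ, Continuous f → IntervalIntegrable f volume 0 (z / K) :=
    fun f hf => hf.intervalIntegrable _ _
  calc orderIntegral K T ω z
      = ∫ v in (0 : ℝ)..(z / K), ((∑ t ∈ Finset.range (T + 1),
          (T.choose t : ℝ) * (-1) ^ t * (ω * Real.exp (-(((t : ℝ) + K + 1) * ω * v)))) -
        ∑ t ∈ Finset.range (T + 1), ∑ k ∈ Finset.range K, ∑ m ∈ Finset.range (k + 1),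
          (T.choose t : ℝ) * (k.choose m : ℝ) *
          ((-1) ^ (t + m) * (K : ℝ) ^ m * (z * ω) ^ (k - m) * Real.exp (-(z * ω)) /
          (k.factorial : ℝ)) * (ω * ((ω * v) ^ m * Real.exp (-(((t : ℝ) + 1) * ω * v))))) := by
        refine intervalIntegral.integral_congr fun v _ => ?_
        rw [one_sub_pow_expand, ← Finset.sum_sub_distrib, Finset.mul_sum, Finset.mul_sum]
        refine Finset.sum_congr rfl fun t _ => ?_
        have e1 : Real.exp (-(((t : ℝ) + K + 1) * ω * v)) =
            Real.exp (-ω * v) * Real.exp (-(K * ω * v)) * Real.exp (-ω * v) ^ t := by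
          rw [← Real.exp_nat_mul, ← Real.exp_add, ← Real.exp_add]
          ring_nf
        -- The `v`-dependence cancels here, so the subtracted terms decay at rate `(t + 1) ω`, not
        -- `(t + K + 1) ω`.
        have e2 : Real.exp (-(K * ω * v)) * Real.exp (-(ω * (z - K * v))) =
            Real.exp (-(z * ω)) := by
          rw [← Real.exp_add]
          ring_nf
        have e3 : Real.exp (-(((t : ℝ) + 1) * ω * v)) =
            Real.exp (-ω * v) * Real.exp (-ω * v) ^ t := by
          rw [← Real.exp_nat_mul, ← Real.exp_add]
          ring_nf
        have e4 : ∀ k : ℕ, (ω * (z - K * v)) ^ k / (k.factorial : ℝ) =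
            ∑ m ∈ Finset.range (k + 1), (k.choose m : ℝ) *
              ((-1) ^ m * (K : ℝ) ^ m * (z * ω) ^ (k - m) / (k.factorial : ℝ)) * (ω * v) ^ m := by
          intro k
          rw [show ω * (z - K * v) = -1 * K * (ω * v) + z * ω by ring, add_pow, Finset.sum_div]
          refine Finset.sum_congr rfl fun m _ => ?_
          rw [mul_pow, mul_pow]
          ring
        have e5 : ∑ k ∈ Finset.range K, ∑ m ∈ Finset.range (k + 1),
            (T.choose t : ℝ) * (k.choose m : ℝ) *
            ((-1) ^ (t + m) * (K : ℝ) ^ m * (z * ω) ^ (k - m) * Real.exp (-(z * ω)) /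
            (k.factorial : ℝ)) * (ω * ((ω * v) ^ m * Real.exp (-(((t : ℝ) + 1) * ω * v)))) =
            (T.choose t : ℝ) * (-1) ^ t * Real.exp (-(z * ω)) * ω *
              Real.exp (-(((t : ℝ) + 1) * ω * v)) *
              ∑ k ∈ Finset.range K, (ω * (z - K * v)) ^ k / (k.factorial : ℝ) := by
          rw [Finset.mul_sum]
          refine Finset.sum_congr rfl fun k _ => ?_
          rw [e4, Finset.mul_sum]
          refine Finset.sum_congr rfl fun m _ => ?_
          rw [pow_add]
          ring
        rw [e5, ← e2, e1, e3, erlang]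
        ring
    _ = _ := by
        rw [intervalIntegral.integral_sub (hint _ (by fun_prop)) (hint _ (by fun_prop)),
          intervalIntegral.integral_finsetSum fun _ _ => hint _ (by fun_prop),
          intervalIntegral.integral_finsetSum fun _ _ => hint _ (by fun_prop)]
        congr 1
        refine Finset.sum_congr rfl fun t _ => ?_
        rw [intervalIntegral.integral_finsetSum fun _ _ => hint _ (by fun_prop)]
        refine Finset.sum_congr rfl fun k _ => ?_
        rw [intervalIntegral.integral_finsetSum fun _ _ => hint _ (by fun_prop)]

/-! ### Reduction of the double integral to the order-statistic integral. -/

lemma lowerDensity_eq (ω μ x₀ x : ℝ) :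
    lowerDensity ω μ x₀ x = Real.exp (-ω * μ * x₀) * (ω * Real.exp (-ω * x)) := by
  unfold lowerDensity
  ring

lemma lowerPsi_eq {ω μ : ℝ} (T : ℕ) {v x₀ : ℝ} (hv : 0 ≤ v) :
    lowerPsi ω μ T v x₀ = Real.exp (-ω * μ * x₀) ^ T * (1 - Real.exp (-ω * v)) ^ T := by
  have hset : {x : Fin T → ℝ | ∀ i, 0 ≤ x i ∧ x i ≤ v} = Set.univ.pi fun _ => Set.Icc 0 v := by
    ext x
    simp only [Set.mem_ofPred_eq, Set.mem_pi, Set.mem_univ, true_imp_iff, Set.mem_Icc]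
  rw [lowerPsi, hset, volume_pi, Measure.restrict_pi_pi, integral_fintype_prod_eq_pow,
    integral_Icc_eq_integral_Ioc, ← intervalIntegral.integral_of_le hv, Fintype.card_fin, ← mul_pow]
  simp_rw [lowerDensity_eq]
  rw [intervalIntegral.integral_const_mul, integral_exp_neg_mul]

lemma lowerPhi_eq {ω μ : ℝ} (hω : 0 < ω) (K : ℕ) {z v x₀ : ℝ} (hv : 0 ≤ v) (hz : K * v ≤ z) :
    lowerPhi ω μ K z v x₀ = Real.exp (-ω * μ * x₀) ^ K *
      (Real.exp (-(K * ω * v)) * erlang K (ω * (z - K * v))) := by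
  have he := erlang_nonneg K (u := ω * (z - K * v)) (mul_nonneg hω.le (by linarith))
  have h := pi_expLaw_tailSimplex hω hv K z hz
  have hsub : tailSimplex K v z ⊆ Set.univ.pi fun _ => Set.Ioi 0 := fun x hx i _ =>
    hv.trans_lt (hx.1 i)
  rw [pi_expLaw hω, withDensity_apply _ (measurableSet_tailSimplex _ _ _),
    Measure.restrict_restrict (measurableSet_tailSimplex _ _ _), Set.inter_eq_left.2 hsub] at h
  change ∫ x in tailSimplex K v z, _ = _
  have hprod : ∀ x : Fin K → ℝ, ∏ i, lowerDensity ω μ x₀ (x i) =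
      Real.exp (-ω * μ * x₀) ^ K * ∏ i, ω * Real.exp (-ω * x i) := by
    intro x
    simp_rw [lowerDensity_eq]
    rw [Finset.prod_mul_distrib, Finset.prod_const, Finset.card_univ, Fintype.card_fin]
  simp_rw [hprod]
  rw [integral_const_mul, integral_eq_lintegral_of_nonneg_ae, h, ENNReal.toReal_ofReal]
  · positivity
  · exact Filter.Eventually.of_forall fun x => Finset.prod_nonneg fun i _ => by positivity
  · exact (by fun_prop : Continuous fun x : Fin K → ℝ =>
      ∏ i, ω * Real.exp (-ω * x i)).aestronglyMeasurable

/-- The Laplace transform, at `Mμω`, of the exponential law of mean `φ`. -/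
lemma integral_exp_reference {φ ω μ : ℝ} (hφ : 0 < φ) (hω : 0 ≤ ω) (hμ : 0 ≤ μ) (M : ℕ) :
    ∫ x₀ in Set.Ioi (0 : ℝ), Real.exp (-ω * μ * x₀) ^ M * (1 / φ * Real.exp (-x₀ / φ)) =
      1 / (M * μ * ω * φ + 1) := by
  have h : ∀ x₀ : ℝ, Real.exp (-ω * μ * x₀) ^ M * (1 / φ * Real.exp (-x₀ / φ)) =
      1 / φ * Real.exp (-(M * μ * ω + 1 / φ) * x₀) := by
    intro x₀
    rw [← Real.exp_nat_mul, mul_left_comm, ← Real.exp_add]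
    ring_nf
  have hpos : 0 < M * μ * ω + 1 / φ := by positivity
  simp_rw [h]
  rw [integral_const_mul, integral_exp_mul_Ioi (by linarith)]
  simp only [mul_zero, Real.exp_zero]
  field_simp

lemma lowerOutage_eq_orderIntegral {M K : ℕ} (hK : 1 ≤ K) (hKM : K < M) {φ ω μ z : ℝ}
    (hφ : 0 < φ) (hω : 0 < ω) (hμ : 0 ≤ μ) (hz : 0 ≤ z) :
    lowerOutage M K φ ω μ z = (M.choose K : ℝ) * (((M - K - 1 : ℕ) : ℝ) + 1) *
      (1 / (M * μ * ω * φ + 1)) * orderIntegral K (M - K - 1) ω z := by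
  have hK' : (0 : ℝ) < K := by exact_mod_cast hK
  have h : ∀ x₀ : ℝ, (∫ v in (0 : ℝ)..(z / K),
      (M.choose K : ℝ) * (((M - K - 1 : ℕ) : ℝ) + 1) *
      lowerPhi ω μ K z v x₀ * lowerPsi ω μ (M - K - 1) v x₀ * lowerDensity ω μ x₀ v *
        (1 / φ * Real.exp (-x₀ / φ))) =
      (M.choose K : ℝ) * (((M - K - 1 : ℕ) : ℝ) + 1) * orderIntegral K (M - K - 1) ω z *
        (Real.exp (-ω * μ * x₀) ^ M * (1 / φ * Real.exp (-x₀ / φ))) := by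
    intro x₀
    rw [orderIntegral, ← intervalIntegral.integral_const_mul, ← intervalIntegral.integral_mul_const]
    refine intervalIntegral.integral_congr fun v hv => ?_
    rw [Set.uIcc_of_le (by positivity)] at hv
    have h' : K * v ≤ z := by
      have := hv.2
      rwa [le_div_iff₀' hK'] at this
    rw [lowerPhi_eq hω K hv.1 h', lowerPsi_eq _ hv.1, lowerDensity_eq]
    -- The `K + T + 1 = M` densities contribute one such factor each, so the `x₀`-dependence
    -- separates from the integral over `v`.
    have hM : Real.exp (-ω * μ * x₀) ^ M = Real.exp (-ω * μ * x₀) ^ K *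
        Real.exp (-ω * μ * x₀) ^ (M - K - 1) * Real.exp (-ω * μ * x₀) := by
      rw [← pow_add, ← pow_succ]
      congr 1
      omega
    rw [hM]
    ring
  unfold lowerOutage
  simp_rw [h]
  rw [integral_const_mul, integral_exp_reference hφ hω.le hμ]
  ring

lemma lowerOutage_eq_closed {M K : ℕ} (hK : 1 ≤ K) (hKM : K < M) {φ ω μ z : ℝ}
    (hφ : 0 < φ) (hω : 0 < ω) (hμ : 0 ≤ μ) (hz : 0 ≤ z) :
    lowerOutage M K φ ω μ z = lowerOutageClosed M K φ ω μ z := by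
  rw [lowerOutage_eq_orderIntegral hK hKM hφ hω hμ hz, orderIntegral_eq hK, lowerOutageClosed]
  ring

/-! ### Order regions and their measure under independent exponentials. -/

/-- The points at which the coordinates in `S` exceed the coordinate `j` and sum to at most `z`,
and the coordinate `j` exceeds all the others. -/
def orderRegion {ι : Type*} (S : Finset ι) (j : ι) (z : ℝ) : Set (ι → ℝ) :=
  {x | (∀ i ∈ S, x j < x i) ∧ (∀ i, i ∉ S → i ≠ j → x i < x j) ∧ ∑ i ∈ S, x i ≤ z}

lemma measurableSet_orderRegion {ι : Type*} [Fintype ι] (S : Finset ι) (j : ι) (z : ℝ) :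
    MeasurableSet (orderRegion S j z) := by
  unfold orderRegion
  measurability

/-- Reassembles a vector from `K` coordinates, `T` coordinates and a last one. -/
def assemble {K T : ℕ} {ι : Type*} (e : ι ≃ Option (Fin K ⊕ Fin T))
    (p : ((Fin K → ℝ) × (Fin T → ℝ)) × ℝ) (i : ι) : ℝ :=
  Option.elim (e i) p.2 (Sum.elim p.1.1 p.1.2)

/-- Boxes pull back to products of boxes, and these determine a product measure. -/
lemma measurePreserving_assemble {K T : ℕ} {ι : Type*} [Fintype ι]
    (e : ι ≃ Option (Fin K ⊕ Fin T)) (ν : Measure ℝ) [IsProbabilityMeasure ν] :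
    MeasurePreserving (assemble e)
      (((Measure.pi fun _ => ν).prod (Measure.pi fun _ => ν)).prod ν) (Measure.pi fun _ => ν) := by
  have hm : Measurable (assemble (K := K) (T := T) e) := by
    refine measurable_pi_iff.2 fun i => ?_
    unfold assemble
    rcases e i with _ | (a | b)
    · exact measurable_snd
    · exact (measurable_pi_apply a).comp (measurable_fst.comp measurable_fst)
    · exact (measurable_pi_apply b).comp (measurable_snd.comp measurable_fst)
  refine ⟨hm, (Measure.pi_eq fun s hs => ?_).symm⟩
  have hpre : assemble e ⁻¹' Set.univ.pi s =
      ((Set.univ.pi fun a => s (e.symm (some (Sum.inl a)))) ×ˢ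
        (Set.univ.pi fun b => s (e.symm (some (Sum.inr b))))) ×ˢ s (e.symm none) := by
    ext p
    simp only [Set.mem_preimage, Set.mem_pi, Set.mem_univ, true_imp_iff, Set.mem_prod, assemble]
    rw [e.forall_congr_left]
    simp only [Option.forall, Sum.forall, Equiv.apply_symm_apply, Option.elim_none,
      Option.elim_some, Sum.elim_inl, Sum.elim_inr]
    tauto
  rw [Measure.map_apply hm (MeasurableSet.univ_pi hs), hpre, Measure.prod_prod, Measure.prod_prod,
    Measure.pi_pi, Measure.pi_pi, ← e.symm.prod_comp, Fintype.prod_option, Fintype.prod_sum_type,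
    mul_comm]

/-- Regroup the coordinates as `S`, the remaining `T` ports, and `j`. At a fixed value `v` of
coordinate `j` the region is the product of a tail simplex and `Iio v ^ T`, so Fubini gives the
integral of `lintegral_order`. -/
lemma pi_expLaw_orderRegion {M K : ℕ} (hK : 1 ≤ K) {ω z : ℝ} (hω : 0 < ω) (hz : 0 ≤ z)
    {S : Finset (Fin M)} (hS : S.card = K) {j : Fin M} (hj : j ∉ S) :
    Measure.pi (fun _ : Fin M => expLaw ω) (orderRegion S j z) =
      ENNReal.ofReal (orderIntegral K (M - K - 1) ω z) := by
  classical
  have := isProbabilityMeasure_expLaw hω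
  have hcard : (Sᶜ.erase j).card = M - K - 1 := by
    rw [Finset.card_erase_of_mem (by simpa using hj), Finset.card_compl, Fintype.card_fin, hS]
  let g : Option (Fin K ⊕ Fin (M - K - 1)) → Fin M := fun o =>
    Option.elim o j (Sum.elim (S.orderEmbOfFin hS) ((Sᶜ.erase j).orderEmbOfFin hcard))
  have hgS : ∀ a, g (some (Sum.inl a)) ∈ S := fun a => S.orderEmbOfFin_mem hS a
  have hgT : ∀ b, g (some (Sum.inr b)) ∈ Sᶜ.erase j := fun b => Finset.orderEmbOfFin_mem _ hcard b
  have hgS' : ∀ i ∈ S, ∃ a, g (some (Sum.inl a)) = i := fun i hi => by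
    have : i ∈ Set.range (S.orderEmbOfFin hS) := by simpa using hi
    exact this
  have hgT' : ∀ i ∈ Sᶜ.erase j, ∃ b, g (some (Sum.inr b)) = i := fun i hi => by
    have : i ∈ Set.range ((Sᶜ.erase j).orderEmbOfFin hcard) := by
      rw [Finset.range_orderEmbOfFin]
      exact hi
    exact this
  have hg : Function.Bijective g := by
    constructor
    · rintro (_ | (a | a)) (_ | (b | b)) h
      · rfl
      · exact absurd (by have := hgS b; rw [← h] at this; exact this) hj
      · exact absurd (hgT b) (by rw [← h]; simp [g])
      · exact absurd (by have := hgS a; rw [h] at this; exact this) hj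
      · have := (S.orderEmbOfFin hS).injective h
        rw [this]
      · have h1 := hgS a
        have h2 := hgT b
        rw [← h] at h2
        simp [h1] at h2
      · exact absurd (hgT a) (by rw [h]; simp [g])
      · have h1 := hgS b
        have h2 := hgT a
        rw [h] at h2
        simp [h1] at h2
      · have := ((Sᶜ.erase j).orderEmbOfFin hcard).injective h
        rw [this]
    · intro i
      by_cases h1 : i ∈ S
      · exact (hgS' i h1).imp' _ fun a ha => ha
      · by_cases h2 : i = j
        · exact ⟨none, h2.symm⟩
        · exact (hgT' i (by simp [h1, h2])).imp' _ fun a ha => ha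
  let e : Fin M ≃ Option (Fin K ⊕ Fin (M - K - 1)) := (Equiv.ofBijective g hg).symm
  have heg : ∀ o, e (g o) = o := fun o => (Equiv.ofBijective g hg).symm_apply_apply o
  have mp := measurePreserving_assemble e (expLaw ω)
  have hpre : assemble e ⁻¹' orderRegion S j z =
      {p | p.1.1 ∈ tailSimplex K p.2 z ∧ p.1.2 ∈ Set.univ.pi fun _ => Set.Iio p.2} := by
    ext p
    have hval : ∀ o, assemble e p (g o) = Option.elim o p.2 (Sum.elim p.1.1 p.1.2) := fun o => by
      rw [assemble, heg]
    have hvj : assemble e p j = p.2 := hval none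
    have hsum : ∑ i ∈ S, assemble e p i = ∑ a, p.1.1 a := by
      refine (Finset.sum_bij (fun a _ => g (some (Sum.inl a))) (fun a _ => hgS a)
        (fun a _ b _ h => ?_) (fun i hi => ?_) (fun a _ => (hval _).symm)).symm
      · simpa using hg.1 h
      · obtain ⟨a, ha⟩ := hgS' i hi
        exact ⟨a, Finset.mem_univ _, ha⟩
    simp only [orderRegion, tailSimplex, Set.mem_preimage, Set.mem_ofPred_eq, hvj, hsum, Set.mem_pi,
      Set.mem_univ, true_imp_iff, Set.mem_Iio]
    constructor
    · rintro ⟨h1, h2, h3⟩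
      refine ⟨⟨fun a => ?_, h3⟩, fun b => ?_⟩
      · have := h1 _ (hgS a)
        rwa [hval] at this
      · have hb := hgT b
        rw [Finset.mem_erase, Finset.mem_compl] at hb
        have := h2 _ hb.2 hb.1
        rwa [hval] at this
    · rintro ⟨⟨h1, h3⟩, h2⟩
      refine ⟨fun i hi => ?_, fun i hi hij => ?_, h3⟩
      · obtain ⟨a, rfl⟩ := hgS' i hi
        rw [hval]
        exact h1 a
      · obtain ⟨b, rfl⟩ := hgT' i (by simp [hi, hij])
        rw [hval]
        exact h2 b
  have hmeas := mp.measurable (measurableSet_orderRegion S j z)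
  rw [← mp.measure_preimage (measurableSet_orderRegion S j z).nullMeasurableSet,
    Measure.prod_apply_symm hmeas, ← lintegral_order hω hK hz]
  refine lintegral_congr fun v => ?_
  rw [hpre]
  have hslice : (fun x : (Fin K → ℝ) × (Fin (M - K - 1) → ℝ) => (x, v)) ⁻¹'
      {p | p.1.1 ∈ tailSimplex K p.2 z ∧ p.1.2 ∈ Set.univ.pi fun _ => Set.Iio p.2} =
      tailSimplex K v z ×ˢ Set.univ.pi fun _ => Set.Iio v := rfl
  rw [hslice, Measure.prod_prod, Measure.pi_pi]
  simp

/-! ### The SNR law of a Gaussian channel. -/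

lemma gaussianPDF_half (a : ℝ) {s : ℝ} (hs : 0 < s) (x : ℝ) :
    gaussianPDF a (s / 2).toNNReal x =
      ENNReal.ofReal ((Real.sqrt (Real.pi * s))⁻¹ * Real.exp (-(x - a) ^ 2 / s)) := by
  rw [gaussianPDF, gaussianPDFReal, Real.coe_toNNReal _ (by positivity)]
  rw [show 2 * Real.pi * (s / 2) = Real.pi * s by ring, show 2 * (s / 2) = s by ring]

lemma lintegral_gaussian_prod (a b : ℝ) {s : ℝ} (hs : 0 < s) (F : ℝ × ℝ → ENNReal) :
    ∫⁻ p, F p ∂((gaussianReal a (s / 2).toNNReal).prod (gaussianReal b (s / 2).toNNReal)) =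
      ∫⁻ p : ℝ × ℝ, ENNReal.ofReal (1 / (Real.pi * s) *
        Real.exp (-((p.1 - a) ^ 2 + (p.2 - b) ^ 2) / s)) * F p := by
  have hv : (s / 2).toNNReal ≠ 0 := by
    simpa using hs
  rw [gaussianReal_of_var_ne_zero _ hv, gaussianReal_of_var_ne_zero _ hv,
    prod_withDensity (measurable_gaussianPDF _ _) (measurable_gaussianPDF _ _),
    ← Measure.volume_eq_prod, lintegral_withDensity_eq_lintegral_mul_non_measurable _
      (by fun_prop)]
  · refine lintegral_congr fun p => ?_
    simp only [Pi.mul_apply]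
    rw [gaussianPDF_half _ hs, gaussianPDF_half _ hs, ← ENNReal.ofReal_mul (by positivity)]
    congr 2
    rw [mul_mul_mul_comm, ← Real.exp_add, ← mul_inv, Real.mul_self_sqrt (by positivity), one_div]
    ring_nf
  · exact Filter.Eventually.of_forall fun p =>
      ENNReal.mul_lt_top ENNReal.ofReal_lt_top ENNReal.ofReal_lt_top

lemma integral_gaussian_circle (a b r : ℝ) {s : ℝ} (hs : 0 < s) :
    ∫ θ in -Real.pi..Real.pi, 1 / (Real.pi * s) *
      Real.exp (-((r * Real.cos θ - a) ^ 2 + (r * Real.sin θ - b) ^ 2) / s) =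
      2 / s * (Real.exp (-(r ^ 2 + (a ^ 2 + b ^ 2)) / s) *
        besselI0 (2 * Real.sqrt ((a ^ 2 + b ^ 2) * r ^ 2) / s)) := by
  have h : ∀ θ : ℝ, 1 / (Real.pi * s) *
      Real.exp (-((r * Real.cos θ - a) ^ 2 + (r * Real.sin θ - b) ^ 2) / s) =
      1 / (Real.pi * s) * Real.exp (-(r ^ 2 + (a ^ 2 + b ^ 2)) / s) *
        Real.exp (2 * r * a / s * Real.cos θ + 2 * r * b / s * Real.sin θ) := by
    intro θ
    rw [mul_assoc, ← Real.exp_add]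
    congr 2
    rw [← sub_eq_zero]
    field_simp
    linear_combination (-r ^ 2) * (Real.sin_sq_add_cos_sq θ)
  simp_rw [h]
  rw [intervalIntegral.integral_const_mul, integral_exp_cos_add_sin]
  have : (2 * r * a / s) ^ 2 + (2 * r * b / s) ^ 2 = (2 / s) ^ 2 * ((a ^ 2 + b ^ 2) * r ^ 2) := by
    ring
  rw [this, Real.sqrt_mul (by positivity), Real.sqrt_sq (by positivity),
    show 2 / s * Real.sqrt ((a ^ 2 + b ^ 2) * r ^ 2) =
      2 * Real.sqrt ((a ^ 2 + b ^ 2) * r ^ 2) / s by ring]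
  field_simp

/-- The law of the squared modulus of a Gaussian vector in the plane, up to a factor `q`. -/
lemma lintegral_norm_sq_gaussian (a b : ℝ) {s q : ℝ} (hs : 0 < s) (hq : 0 < q)
    {g : ℝ → ENNReal} (hg : Measurable g) :
    ∫⁻ p, g (q * (p.1 ^ 2 + p.2 ^ 2))
      ∂((gaussianReal a (s / 2).toNNReal).prod (gaussianReal b (s / 2).toNNReal)) =
    ∫⁻ x in Set.Ioi 0, ENNReal.ofReal (1 / (q * s) *
      (Real.exp (-(x / q + (a ^ 2 + b ^ 2)) / s) *
        besselI0 (2 * Real.sqrt ((a ^ 2 + b ^ 2) * (x / q)) / s))) * g x := by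
  rw [lintegral_gaussian_prod a b hs, ← lintegral_comp_polarCoord_symm]
  have himage : (fun r : ℝ => q * r ^ 2) '' Set.Ioi 0 = Set.Ioi 0 := by
    ext x
    constructor
    · rintro ⟨r, hr, rfl⟩
      have : 0 < r := hr
      exact mul_pos hq (by positivity)
    · intro hx
      have hx : 0 < x := hx
      refine ⟨Real.sqrt (x / q), Real.sqrt_pos.2 (by positivity), ?_⟩
      simp only
      rw [Real.sq_sqrt (by positivity)]
      field_simp
  have hinj : Set.InjOn (fun r : ℝ => q * r ^ 2) (Set.Ioi 0) := by
    intro x hx y hy hxy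
    have hx : 0 < x := hx
    have hy : 0 < y := hy
    have : x ^ 2 = y ^ 2 := mul_left_cancel₀ hq.ne' hxy
    exact (pow_left_inj₀ hx.le hy.le two_ne_zero).1 this
  have hder : ∀ r ∈ Set.Ioi (0 : ℝ),
      HasDerivWithinAt (fun r : ℝ => q * r ^ 2) (q * (2 * r)) (Set.Ioi 0) r := fun r _ => by
    simpa using ((hasDerivAt_pow 2 r).const_mul q).hasDerivWithinAt
  -- Substituting `x = q r²` on the right makes both sides integrals over the radius, compared
  -- pointwise after the angular integration.
  conv_rhs => rw [← himage, lintegral_image_eq_lintegral_abs_deriv_mul measurableSet_Ioi hder hinj]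
  rw [polarCoord_target, Measure.volume_eq_prod, ← Measure.prod_restrict, lintegral_prod]
  · refine setLIntegral_congr_fun measurableSet_Ioi fun r hr => ?_
    have hr : 0 < r := hr
    have hrad : ∀ θ : ℝ, (r * Real.cos θ) ^ 2 + (r * Real.sin θ) ^ 2 = r ^ 2 := fun θ => by
      linear_combination r ^ 2 * Real.sin_sq_add_cos_sq θ
    simp only [polarCoord_symm_apply, hrad, smul_eq_mul]
    rw [lintegral_const_mul _ (by fun_prop), lintegral_mul_const _ (by fun_prop),
      Measure.restrict_congr_set Ioo_ae_eq_Ioc,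
      lintegral_ofReal_Ioc (by linarith [Real.pi_pos]) (by fun_prop)
        (fun θ _ => by positivity), integral_gaussian_circle a b r hs, ← mul_assoc,
      ← mul_assoc (ENNReal.ofReal |_|), ← ENNReal.ofReal_mul hr.le,
      ← ENNReal.ofReal_mul (abs_nonneg _), abs_of_pos (by positivity),
      mul_div_cancel_left₀ _ hq.ne']
    congr 2
    field_simp
  · simp only [polarCoord_symm_apply]
    fun_prop

lemma complexGaussian_prob (α : ℝ) : IsProbabilityMeasure (complexGaussian α) :=
  Measure.isProbabilityMeasure_map (by fun_prop)

@[fun_prop]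
lemma measurable_snr (Ps N : ℝ) : Measurable (snr Ps N) := by
  unfold snr
  fun_prop

lemma measurable_snr_portChannel {β : Type*} [MeasurableSpace β] (Ps N μ : ℝ) {f g : β → ℂ}
    (hf : Measurable f) (hg : Measurable g) :
    Measurable fun b => snr Ps N (portChannel μ (f b) (g b)) := by
  unfold snr portChannel
  fun_prop

lemma aemeasurable_snr_portChannel {β : Type*} [MeasurableSpace β] {P : Measure β} (Ps N μ : ℝ)
    {f g : β → ℂ} (hf : AEMeasurable f P) (hg : AEMeasurable g P) :
    AEMeasurable (fun b => snr Ps N (portChannel μ (f b) (g b))) P := by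
  unfold snr portChannel
  fun_prop

/-- The law with density `condDensity ω μ x₀` on `(0, ∞)`. -/
def riceLaw (ω μ x₀ : ℝ) : Measure ℝ :=
  (volume.restrict (Set.Ioi (0 : ℝ))).withDensity fun x => ENNReal.ofReal (condDensity ω μ x₀ x)

/-- For fixed reference channel `c`, the port channel has independent Gaussian parts with means `√μ
c.re`, `√μ c.im` and variance `(1 - μ) α / 2`. The resulting SNR law depends on `c` only through its
SNR. -/
lemma map_snr_portChannel {Ps α N μ φ ω : ℝ} (hPs : 0 < Ps) (hα : 0 < α) (hN : 0 < N)
    (hμ0 : 0 ≤ μ) (hμ1 : μ < 1) (hφ : φ = Ps * α / N) (hω : ω = (φ * (1 - μ))⁻¹) (c : ℂ) :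
    (complexGaussian α).map (fun e => snr Ps N (portChannel μ c e)) =
      riceLaw ω μ (snr Ps N c) := by
  have hμ1' : 0 < 1 - μ := by linarith
  have hmeas : Measurable fun e => snr Ps N (portChannel μ c e) :=
    measurable_snr_portChannel Ps N μ measurable_const measurable_id
  have hmap : ∀ d : ℝ, (gaussianReal 0 (α / 2).toNNReal).map
      (fun x => Real.sqrt μ * d + Real.sqrt (1 - μ) * x) =
      gaussianReal (Real.sqrt μ * d) ((1 - μ) * α / 2).toNNReal := by
    intro d
    have h1 := gaussianReal_map_const_mul (μ := 0) (v := (α / 2).toNNReal) (Real.sqrt (1 - μ))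
    have h2 := gaussianReal_map_const_add (μ := 0) (v := ((1 - μ) * α / 2).toNNReal)
      (Real.sqrt μ * d)
    have hv : (NNReal.mk (Real.sqrt (1 - μ) ^ 2) (sq_nonneg _)) * (α / 2).toNNReal =
        ((1 - μ) * α / 2).toNNReal := by
      apply NNReal.coe_injective
      rw [NNReal.coe_mul, Real.coe_toNNReal _ (by positivity), Real.coe_toNNReal _ (by positivity),
        NNReal.coe_mk, Real.sq_sqrt hμ1'.le]
      ring
    rw [mul_zero, hv] at h1
    rw [zero_add, ← h1, Measure.map_map (by fun_prop) (by fun_prop)] at h2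
    exact h2
  refine Measure.ext_of_lintegral _ fun g hg => ?_
  rw [lintegral_map hg hmeas, complexGaussian,
    lintegral_map (f := fun e => g (snr Ps N (portChannel μ c e))) (hg.comp hmeas)
      (MeasurableEquiv.measurable _)]
  have hq : 0 < Ps / N := by positivity
  have hs : 0 < (1 - μ) * α := by positivity
  have key := lintegral_norm_sq_gaussian (Real.sqrt μ * c.re) (Real.sqrt μ * c.im) hs hq hg
  rw [← hmap, ← hmap, Measure.map_prod_map _ _ (by fun_prop) (by fun_prop),
    lintegral_map (by fun_prop) (by fun_prop)] at key
  have hpoint : ∀ p : ℝ × ℝ, snr Ps N (portChannel μ c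
      (Complex.measurableEquivRealProd.symm p)) = Ps / N *
        ((Real.sqrt μ * c.re + Real.sqrt (1 - μ) * p.1) ^ 2 +
          (Real.sqrt μ * c.im + Real.sqrt (1 - μ) * p.2) ^ 2) := by
    intro p
    rw [snr, portChannel, ← Complex.normSq_eq_norm_sq, Complex.normSq_apply]
    simp [Complex.measurableEquivRealProd]
    ring
  simp only [Prod.map_fst, Prod.map_snd] at key
  simp only [hpoint]
  rw [key, riceLaw, lintegral_withDensity_eq_lintegral_mul_non_measurable _
    (measurable_condDensity _ _ _).ennreal_ofReal
    (Filter.Eventually.of_forall fun _ => ENNReal.ofReal_lt_top)]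
  refine setLIntegral_congr_fun measurableSet_Ioi fun x hx => ?_
  have hx : 0 < x := hx
  simp only [Pi.mul_apply]
  congr 2
  have hω' : ω = N / (Ps * ((1 - μ) * α)) := by
    rw [hω, hφ]
    field_simp
  have hnorm : (Real.sqrt μ * c.re) ^ 2 + (Real.sqrt μ * c.im) ^ 2 = μ * ‖c‖ ^ 2 := by
    rw [← Complex.normSq_eq_norm_sq, Complex.normSq_apply, mul_pow, mul_pow, Real.sq_sqrt hμ0]
    ring
  rw [hnorm, condDensity, snr]
  have hsqrt : Real.sqrt (μ * (Ps * ‖c‖ ^ 2 / N) * x) =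
      Ps / N * Real.sqrt (μ * ‖c‖ ^ 2 * (x / (Ps / N))) := by
    conv_rhs => rw [← Real.sqrt_sq hq.le, ← Real.sqrt_mul (by positivity)]
    rw [Real.sqrt_sq hq.le]
    congr 1
    field_simp
  rw [hsqrt, hω', ← mul_assoc]
  congr 2
  · field_simp
  · congr 1
    field_simp
  · field_simp

lemma snr_nonneg {Ps N : ℝ} (hPs : 0 < Ps) (hN : 0 < N) (h : ℂ) : 0 ≤ snr Ps N h := by
  unfold snr
  positivity

lemma snr_sqrt {Ps N : ℝ} (hPs : 0 < Ps) (hN : 0 < N) {x : ℝ} (hx : 0 ≤ x) :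
    snr Ps N (Real.sqrt (N * x / Ps) : ℂ) = x := by
  rw [snr, Complex.norm_real, Real.norm_eq_abs, sq_abs, Real.sq_sqrt (by positivity)]
  field_simp

/-- The uncorrelated case `μ = 0` of `map_snr_portChannel`, where the Bessel factor is `I₀ 0 = 1`.
-/
lemma map_snr {Ps α N φ : ℝ} (hPs : 0 < Ps) (hα : 0 < α) (hN : 0 < N) (hφ : φ = Ps * α / N) :
    (complexGaussian α).map (snr Ps N) = expLaw φ⁻¹ := by
  have h := map_snr_portChannel (ω := φ⁻¹) hPs hα hN le_rfl zero_lt_one hφ (by simp) 0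
  have h1 : (fun e => snr Ps N (portChannel 0 0 e)) = snr Ps N := by
    ext e
    simp [portChannel]
  have hI : besselI0 0 = 1 := by
    refine (hasSum_besselI0 0).unique ?_
    convert! hasSum_ite_eq (0 : ℕ) (1 : ℝ) using 2 with k
    rcases k with _ | k <;> simp
  rw [h1] at h
  rw [h, riceLaw, expLaw]
  congr 1
  ext x
  simp [condDensity, hI]

/-! ### The conditional law of a port SNR. -/

/-- The law of a port SNR, as a function of the reference SNR. -/
def portKernel (Ps N μ α : ℝ) : Kernel ℝ ℝ :=
  (Kernel.deterministic (fun x : ℝ => x) measurable_id ×ₖ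
    Kernel.const ℝ (complexGaussian α)).map
    fun p => snr Ps N (portChannel μ (Real.sqrt (N * p.1 / Ps) : ℂ) p.2)

lemma measurable_portKernel_map (Ps N μ : ℝ) :
    Measurable fun p : ℝ × ℂ => snr Ps N (portChannel μ (Real.sqrt (N * p.1 / Ps) : ℂ) p.2) :=
  measurable_snr_portChannel Ps N μ (by fun_prop) measurable_snd

instance (Ps N μ α : ℝ) : IsMarkovKernel (portKernel Ps N μ α) := by
  have := complexGaussian_prob α
  unfold portKernel
  exact Kernel.IsMarkovKernel.map _ (measurable_portKernel_map Ps N μ)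

/-- The kernel uses the real channel `√(N x₀ / Ps)` as a representative of SNR `x₀`; any other
channel of that SNR gives the same law. For negative `x₀` the square root is zero, which keeps the
kernel Markov on all of `ℝ`. -/
lemma portKernel_apply {Ps α N μ φ ω : ℝ} (hPs : 0 < Ps) (hα : 0 < α) (hN : 0 < N)
    (hμ0 : 0 ≤ μ) (hμ1 : μ < 1) (hφ : φ = Ps * α / N) (hω : ω = (φ * (1 - μ))⁻¹)
    {x₀ : ℝ} (hx₀ : 0 ≤ x₀) : portKernel Ps N μ α x₀ = riceLaw ω μ x₀ := by
  have := complexGaussian_prob α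
  have h := map_snr_portChannel hPs hα hN hμ0 hμ1 hφ hω (Real.sqrt (N * x₀ / Ps) : ℂ)
  rw [snr_sqrt hPs hN hx₀] at h
  rw [← h, portKernel, Kernel.map_apply _ (measurable_portKernel_map Ps N μ), Kernel.prod_apply,
    Kernel.deterministic_apply, Kernel.const_apply, Measure.dirac_prod,
    Measure.map_map (measurable_portKernel_map Ps N μ) (by fun_prop)]
  rfl

lemma map_snr_prod_eq_compProd {Ps α N μ φ ω : ℝ} (hPs : 0 < Ps) (hα : 0 < α) (hN : 0 < N)
    (hμ0 : 0 ≤ μ) (hμ1 : μ < 1) (hφ : φ = Ps * α / N) (hω : ω = (φ * (1 - μ))⁻¹) :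
    ((complexGaussian α).prod (complexGaussian α)).map
        (fun p => (snr Ps N p.1, snr Ps N (portChannel μ p.1 p.2))) =
      (complexGaussian α).map (snr Ps N) ⊗ₘ portKernel Ps N μ α := by
  have := complexGaussian_prob α
  have := Measure.isProbabilityMeasure_map (μ := complexGaussian α)
    (measurable_snr Ps N).aemeasurable
  have hm : Measurable fun p : ℂ × ℂ => (snr Ps N p.1, snr Ps N (portChannel μ p.1 p.2)) :=
    ((measurable_snr Ps N).comp measurable_fst).prodMk
      (measurable_snr_portChannel Ps N μ measurable_fst measurable_snd)
  ext s hs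
  rw [Measure.map_apply hm hs, Measure.prod_apply (hm hs), Measure.compProd_apply hs,
    lintegral_map (Kernel.measurable_kernel_prodMk_left hs) (measurable_snr Ps N)]
  refine lintegral_congr fun c => ?_
  rw [portKernel_apply hPs hα hN hμ0 hμ1 hφ hω (snr_nonneg hPs hN c),
    ← map_snr_portChannel hPs hα hN hμ0 hμ1 hφ hω c, Measure.map_apply
      (f := fun e => snr Ps N (portChannel μ c e))
      (measurable_snr_portChannel Ps N μ measurable_const measurable_id)
      (measurable_prodMk_left hs)]
  rfl

lemma condDistrib_snr {Ω : Type*} [MeasurableSpace Ω] {P : Measure Ω} [IsProbabilityMeasure P]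
    {Ps α N μ φ ω : ℝ} (hPs : 0 < Ps) (hα : 0 < α) (hN : 0 < N)
    (hμ0 : 0 ≤ μ) (hμ1 : μ < 1) (hφ : φ = Ps * α / N) (hω : ω = (φ * (1 - μ))⁻¹)
    {h₀ e : Ω → ℂ} (hlaw₀ : HasLaw h₀ (complexGaussian α) P)
    (hlaw : HasLaw e (complexGaussian α) P) (hindep : IndepFun h₀ e P) :
    ∀ᵐ x₀ ∂(P.map fun s => snr Ps N (h₀ s)),
      condDistrib (fun s => snr Ps N (portChannel μ (h₀ s) (e s))) (fun s => snr Ps N (h₀ s)) P x₀ =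
        riceLaw ω μ x₀ := by
  have h0 := hlaw₀.aemeasurable
  have he := hlaw.aemeasurable
  have hpair : AEMeasurable (fun s => (h₀ s, e s)) P := h0.prodMk he
  have hjoint := (indepFun_iff_map_prod_eq_prod_map_map h0 he).1 hindep
  rw [hlaw₀.map_eq, hlaw.map_eq] at hjoint
  have hmap₀ : P.map (fun s => snr Ps N (h₀ s)) = (complexGaussian α).map (snr Ps N) := by
    rw [← hlaw₀.map_eq, AEMeasurable.map_map_of_aemeasurable (by fun_prop) h0]
    rfl
  have hm : Measurable fun p : ℂ × ℂ => (snr Ps N p.1, snr Ps N (portChannel μ p.1 p.2)) :=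
    ((measurable_snr Ps N).comp measurable_fst).prodMk
      (measurable_snr_portChannel Ps N μ measurable_fst measurable_snd)
  have hκ : P.map (fun s => (snr Ps N (h₀ s), snr Ps N (portChannel μ (h₀ s) (e s)))) =
      P.map (fun s => snr Ps N (h₀ s)) ⊗ₘ portKernel Ps N μ α := by
    rw [hmap₀, ← map_snr_prod_eq_compProd hPs hα hN hμ0 hμ1 hφ hω, ← hjoint,
      AEMeasurable.map_map_of_aemeasurable hm.aemeasurable hpair]
    rfl
  have hY : AEMeasurable (fun s => snr Ps N (portChannel μ (h₀ s) (e s))) P :=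
    aemeasurable_snr_portChannel Ps N μ h0 he
  have h1 := condDistrib_ae_eq_of_measure_eq_compProd (fun s => snr Ps N (h₀ s)) hY hκ
  have h2 : ∀ᵐ x₀ ∂(P.map fun s => snr Ps N (h₀ s)), 0 ≤ x₀ :=
    (ae_map_iff ((measurable_snr Ps N).comp_aemeasurable h0) measurableSet_Ici).2
      (Filter.Eventually.of_forall fun s => snr_nonneg hPs hN (h₀ s))
  filter_upwards [h1, h2] with x₀ hx hx₀
  rw [hx, portKernel_apply hPs hα hN hμ0 hμ1 hφ hω hx₀]

/-! ### Domination of the joint SNR law by independent exponentials from below. -/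

lemma smul_expLaw_le_riceLaw {ω μ x₀ : ℝ} (hω : 0 ≤ ω) (hμ : 0 ≤ μ) (hx₀ : 0 ≤ x₀) :
    ENNReal.ofReal (Real.exp (-ω * μ * x₀)) • expLaw ω ≤ riceLaw ω μ x₀ := by
  rw [expLaw, riceLaw, ← withDensity_smul _ (by fun_prop)]
  refine withDensity_mono ((ae_restrict_iff' measurableSet_Ioi).2
    (Filter.Eventually.of_forall fun x hx => ?_))
  have hx : 0 < x := hx
  rw [Pi.smul_apply, smul_eq_mul, ← ENNReal.ofReal_mul (by positivity), ← lowerDensity_eq]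
  exact ENNReal.ofReal_le_ofReal (lowerDensity_le_condDensity hω hμ hx₀ hx.le)

/-- An inequality on boxes does not in general extend to all measurable sets. Here it does, because
the product measure comes from the largest outer measure bounded on boxes by the product of the side
measures. -/
lemma pow_smul_pi_le_pi {ι X : Type*} [Fintype ι] [MeasurableSpace X] {ν ρ : Measure X}
    [SigmaFinite ν] [SigmaFinite ρ] {c : ENNReal} (h : c • ν ≤ ρ) :
    c ^ Fintype.card ι • Measure.pi (fun _ : ι => ν) ≤ Measure.pi fun _ : ι => ρ := by
  refine Measure.le_iff.2 fun s hs => ?_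
  rw [Measure.pi_def (fun _ : ι => ρ), toMeasure_apply _ _ hs]
  refine (OuterMeasure.le_pi (n := (c ^ Fintype.card ι •
    Measure.pi (fun _ : ι => ν)).toOuterMeasure)).2 (fun t _ => ?_) s
  simp only [Measure.coe_toOuterMeasure]
  rw [Measure.smul_apply, Measure.pi_pi, smul_eq_mul, ← Finset.card_univ, ← Finset.prod_const,
    ← Finset.prod_mul_distrib]
  exact Finset.prod_le_prod' fun i _ => h (t i)

lemma map_channels {Ω : Type*} [MeasurableSpace Ω] {P : Measure Ω} [IsProbabilityMeasure P]
    {M : ℕ} {α : ℝ} {h₀ : Ω → ℂ} {e : Fin M → Ω → ℂ}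
    (hlaw₀ : HasLaw h₀ (complexGaussian α) P) (hlaw : ∀ m, HasLaw (e m) (complexGaussian α) P)
    (hindep : iIndepFun (fun i : Option (Fin M) => Option.elim i h₀ e) P) :
    P.map (fun s => ((fun m => e m s), h₀ s)) =
      (Measure.pi fun _ : Fin M => complexGaussian α).prod (complexGaussian α) := by
  have := complexGaussian_prob α
  have hm : ∀ i : Option (Fin M), AEMeasurable (Option.elim i h₀ e) P := by
    rintro (_ | m)
    · exact hlaw₀.aemeasurable
    · exact (hlaw m).aemeasurable
  have hall := (iIndepFun_iff_map_fun_eq_pi_map hm).1 hindep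
  have hconst : (fun i : Option (Fin M) => P.map (Option.elim i h₀ e)) =
      fun _ => complexGaussian α := by
    ext1 i
    rcases i with _ | m
    · exact hlaw₀.map_eq
    · exact (hlaw m).map_eq
  rw [hconst, ← Measure.pi_map_piOptionEquivProd] at hall
  have h2 := congrArg (Measure.map (MeasurableEquiv.piOptionEquivProd fun _ : Option (Fin M) => ℂ))
    hall
  rw [MeasurableEquiv.map_map_symm] at h2
  rw [← h2, AEMeasurable.map_map_of_aemeasurable (by fun_prop) (aemeasurable_pi_iff.2 hm)]
  rfl

lemma lintegral_exp_snr {Ps α N μ φ ω : ℝ} (hPs : 0 < Ps) (hα : 0 < α) (hN : 0 < N)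
    (hμ0 : 0 ≤ μ) (hφ : φ = Ps * α / N) (hω : 0 < ω) (M : ℕ) :
    ∫⁻ c, ENNReal.ofReal (Real.exp (-ω * μ * snr Ps N c)) ^ M ∂(complexGaussian α) =
      ENNReal.ofReal (1 / (M * μ * ω * φ + 1)) := by
  have hφ0 : 0 < φ := hφ ▸ by positivity
  rw [← lintegral_map (f := fun x => ENNReal.ofReal (Real.exp (-ω * μ * x)) ^ M) (by fun_prop)
    (measurable_snr Ps N), map_snr hPs hα hN hφ, lintegral_expLaw,
    ← integral_exp_reference hφ0 hω.le hμ0, ofReal_integral_eq_lintegral_ofReal]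
  · refine lintegral_congr fun x => ?_
    rw [← ENNReal.ofReal_pow (by positivity), ← ENNReal.ofReal_mul (by positivity)]
    congr 1
    rw [mul_comm, one_div, show -φ⁻¹ * x = -x / φ by ring]
  · refine Integrable.of_integral_ne_zero ?_
    rw [integral_exp_reference hφ0 hω.le hμ0]
    positivity
  · exact Filter.Eventually.of_forall fun x => by positivity

/-- Condition on `h₀`, bound the product of Rice laws below by `exp (-ωμx₀) ^ M` times the
exponential product, which no longer involves `h₀`, and average the factor. -/
lemma le_measure_snr_mem {Ω : Type*} [MeasurableSpace Ω] {P : Measure Ω} [IsProbabilityMeasure P]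
    {M : ℕ} {Ps α N μ φ ω : ℝ} (hPs : 0 < Ps) (hα : 0 < α) (hN : 0 < N)
    (hμ0 : 0 ≤ μ) (hμ1 : μ < 1) (hφ : φ = Ps * α / N) (hω : ω = (φ * (1 - μ))⁻¹) (hω0 : 0 < ω)
    {h₀ : Ω → ℂ} {e : Fin M → Ω → ℂ}
    (hlaw₀ : HasLaw h₀ (complexGaussian α) P) (hlaw : ∀ m, HasLaw (e m) (complexGaussian α) P)
    (hindep : iIndepFun (fun i : Option (Fin M) => Option.elim i h₀ e) P)
    {A : Set (Fin M → ℝ)} (hA : MeasurableSet A) :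
    ENNReal.ofReal (1 / (M * μ * ω * φ + 1)) * Measure.pi (fun _ : Fin M => expLaw ω) A ≤
      P {s | (fun m => snr Ps N (portChannel μ (h₀ s) (e m s))) ∈ A} := by
  have := complexGaussian_prob α
  have := isProbabilityMeasure_expLaw hω0
  have hp : ∀ c : ℂ, Measurable fun x => snr Ps N (portChannel μ c x) := fun c =>
    measurable_snr_portChannel Ps N μ measurable_const measurable_id
  have hG : Measurable fun p : (Fin M → ℂ) × ℂ =>
      fun m => snr Ps N (portChannel μ p.2 (p.1 m)) :=
    measurable_pi_iff.2 fun m => measurable_snr_portChannel Ps N μ measurable_snd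
      ((measurable_pi_apply m).comp measurable_fst)
  have hpair : AEMeasurable (fun s => ((fun m => e m s), h₀ s)) P :=
    (aemeasurable_pi_iff.2 fun m => (hlaw m).aemeasurable).prodMk hlaw₀.aemeasurable
  have h1 : P {s | (fun m => snr Ps N (portChannel μ (h₀ s) (e m s))) ∈ A} =
      ∫⁻ c, Measure.pi (fun _ : Fin M => riceLaw ω μ (snr Ps N c)) A ∂(complexGaussian α) := by
    calc P {s | (fun m => snr Ps N (portChannel μ (h₀ s) (e m s))) ∈ A}
        = P.map (fun s => ((fun m => e m s), h₀ s))
            ((fun p : (Fin M → ℂ) × ℂ => fun m => snr Ps N (portChannel μ p.2 (p.1 m))) ⁻¹' A) :=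
          (Measure.map_apply_of_aemeasurable hpair (hG hA)).symm
      _ = _ := by
          rw [map_channels hlaw₀ hlaw hindep, Measure.prod_apply_symm (hG hA)]
          refine lintegral_congr fun c => ?_
          rw [← map_snr_portChannel hPs hα hN hμ0 hμ1 hφ hω c,
            ← Measure.pi_map_pi fun _ => (hp c).aemeasurable,
            Measure.map_apply (f := fun x : Fin M → ℂ => fun m => snr Ps N (portChannel μ c (x m)))
              (measurable_pi_iff.2 fun m => (hp c).comp (measurable_pi_apply m)) hA]
          rfl
  rw [h1, ← lintegral_exp_snr hPs hα hN hμ0 hφ hω0 M, ← lintegral_mul_const _ (by fun_prop)]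
  refine lintegral_mono fun c => ?_
  have : IsProbabilityMeasure (riceLaw ω μ (snr Ps N c)) := by
    rw [← map_snr_portChannel hPs hα hN hμ0 hμ1 hφ hω c]
    exact Measure.isProbabilityMeasure_map (hp c).aemeasurable
  have h := pow_smul_pi_le_pi (ι := Fin M)
    (smul_expLaw_le_riceLaw hω0.le hμ0 (snr_nonneg hPs hN c)) A
  simpa using h

/-! ### Selection of the best ports and the outage bound. -/

lemma isBestPorts_of_mem_orderRegion {M K : ℕ} {S : Finset (Fin M)} (hS : S.card = K) {j : Fin M}
    {z : ℝ} {x : Fin M → ℝ} (hx : x ∈ orderRegion S j z) : IsBestPorts K x S := by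
  refine ⟨hS, fun i hi k hk => ?_⟩
  by_cases h : k = j
  · exact h ▸ (hx.1 i hi).le
  · exact (hx.2.1 k hk h).le.trans (hx.1 i hi).le

/-- Strict separation by `x j` makes the selection unique, so tie-breaking is irrelevant on these
regions. If `S' ≠ S`, equal cardinality gives `i ∈ S' \ S` and `k ∈ S \ S'`, whence `x k ≤ x i ≤ x j
< x k`. -/
lemma eq_of_isBestPorts {M K : ℕ} {S S' : Finset (Fin M)} (hS : S.card = K) {j : Fin M}
    {z : ℝ} {x : Fin M → ℝ} (hx : x ∈ orderRegion S j z) (hS' : IsBestPorts K x S') : S' = S := by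
  by_contra hne
  have h1 : ¬ S' ⊆ S := fun h => hne (Finset.eq_of_subset_of_card_le h (by rw [hS, hS'.1]))
  have h2 : ¬ S ⊆ S' := fun h => hne (Finset.eq_of_subset_of_card_le h (by rw [hS, hS'.1])).symm
  obtain ⟨i, hi', hi⟩ := Finset.not_subset.1 h1
  obtain ⟨k, hk, hk'⟩ := Finset.not_subset.1 h2
  have h3 := hS'.2 i hi' k hk'
  have h4 := hx.1 k hk
  have h5 : x i ≤ x j := by
    by_cases h : i = j
    · rw [h]
    · exact (hx.2.1 i hi h).le
  linarith

lemma disjoint_orderRegion {M K : ℕ} {S S' : Finset (Fin M)} (hS : S.card = K) (hS' : S'.card = K)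
    {j j' : Fin M} (hj : j ∉ S) (hj' : j' ∉ S') {z : ℝ} {x : Fin M → ℝ}
    (hx : x ∈ orderRegion S j z) (hx' : x ∈ orderRegion S' j' z) : S = S' ∧ j = j' := by
  have h := eq_of_isBestPorts hS' hx' (isBestPorts_of_mem_orderRegion hS hx)
  subst h
  refine ⟨rfl, ?_⟩
  by_contra hne
  have h1 := hx.2.1 j' hj' (Ne.symm hne)
  have h2 := hx'.2.1 j hj hne
  linarith

lemma lowerOutage_le_outage {Ω : Type*} [MeasurableSpace Ω] {P : Measure Ω}
    [IsProbabilityMeasure P] {M K : ℕ} (hK : 1 ≤ K) (hKM : K < M)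
    {Ps α N μ R φ ω z : ℝ} (hPs : 0 < Ps) (hα : 0 < α) (hN : 0 < N)
    (hμ0 : 0 ≤ μ) (hμ1 : μ < 1) (hR : 0 ≤ R)
    (hφ : φ = Ps * α / N) (hω : ω = (φ * (1 - μ))⁻¹) (hz : z = 2 ^ R - 1)
    {h₀ : Ω → ℂ} {e : Fin M → Ω → ℂ}
    (hlaw₀ : HasLaw h₀ (complexGaussian α) P) (hlaw : ∀ m, HasLaw (e m) (complexGaussian α) P)
    (hindep : iIndepFun (fun i : Option (Fin M) => Option.elim i h₀ e) P)
    {γ : Fin M → Ω → ℝ} (hγ : ∀ m s, γ m s = snr Ps N (portChannel μ (h₀ s) (e m s)))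
    {sel : Ω → Finset (Fin M)} (hsel : ∀ s, IsBestPorts K (fun m => γ m s) (sel s)) :
    lowerOutage M K φ ω μ z ≤ P.real {s | Real.logb 2 (1 + ∑ m ∈ sel s, γ m s) ≤ R} := by
  classical
  have hφ0 : 0 < φ := hφ ▸ by positivity
  have hω0 : 0 < ω := by
    rw [hω]
    have : 0 < 1 - μ := by linarith
    positivity
  have hz0 : 0 ≤ z := by
    rw [hz, sub_nonneg]
    exact Real.one_le_rpow (by norm_num) hR
  -- Pairs of a `K`-set and a port outside it; their number is the prefactor `choose M K * (T + 1)`,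
  -- as `T + 1 = M - K`.
  let I : Finset (Σ _ : Finset (Fin M), Fin M) :=
    (Finset.powersetCard K Finset.univ).sigma fun S => Sᶜ
  have hI : ∀ i ∈ I, i.1.card = K ∧ i.2 ∉ i.1 := fun i hi => by
    simpa [I, Finset.mem_powersetCard] using hi
  have hcardI : (I.card : ℝ) = (M.choose K : ℝ) * (((M - K - 1 : ℕ) : ℝ) + 1) := by
    have h1 : I.card = M.choose K * (M - K) := by
      rw [Finset.card_sigma, Finset.sum_congr rfl (g := fun _ => M - K), Finset.sum_const,
        Finset.card_powersetCard, Finset.card_univ, Fintype.card_fin, smul_eq_mul]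
      intro S hS
      rw [Finset.card_compl, Fintype.card_fin, (Finset.mem_powersetCard.1 hS).2]
    rw [h1, show M - K = M - K - 1 + 1 by omega]
    push_cast
    rfl
  let B : (Σ _ : Finset (Fin M), Fin M) → Set Ω := fun i =>
    {s | (fun m => snr Ps N (portChannel μ (h₀ s) (e m s))) ∈ orderRegion i.1 i.2 z}
  have hB : ∀ i ∈ I, ENNReal.ofReal (1 / (M * μ * ω * φ + 1) * orderIntegral K (M - K - 1) ω z) ≤
      P (B i) := fun i hi => by
    rw [ENNReal.ofReal_mul (by positivity),
      ← pi_expLaw_orderRegion hK hω0 hz0 (hI i hi).1 (hI i hi).2]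
    exact le_measure_snr_mem hPs hα hN hμ0 hμ1 hφ hω hω0 hlaw₀ hlaw hindep
      (measurableSet_orderRegion _ _ _)
  have hvec : AEMeasurable (fun s => fun m => snr Ps N (portChannel μ (h₀ s) (e m s))) P :=
    aemeasurable_pi_iff.2 fun m => aemeasurable_snr_portChannel Ps N μ hlaw₀.aemeasurable
      (hlaw m).aemeasurable
  have hdisj : (I : Set (Σ _ : Finset (Fin M), Fin M)).Pairwise
      (Function.onFun (AEDisjoint P) B) := by
    intro i hi i' hi' hne
    refine Disjoint.aedisjoint (Set.disjoint_left.2 fun s hs hs' => hne ?_)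
    obtain ⟨h1, h2⟩ := disjoint_orderRegion
      (x := fun m => snr Ps N (portChannel μ (h₀ s) (e m s)))
      (hI i hi).1 (hI i' hi').1 (hI i hi).2 (hI i' hi').2 hs hs'
    exact Sigma.ext h1 (heq_of_eq h2)
  -- Inclusion suffices for a lower bound. The outage event need not be measurable, since
  -- monotonicity holds for arbitrary sets.
  have hsub : (⋃ i ∈ I, B i) ⊆ {s | Real.logb 2 (1 + ∑ m ∈ sel s, γ m s) ≤ R} := by
    intro s hs
    simp only [Set.mem_iUnion] at hs
    obtain ⟨i, hi, hs⟩ := hs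
    have hbest := hsel s
    simp only [hγ] at hbest
    have hS := eq_of_isBestPorts (hI i hi).1 hs hbest
    have hsum : ∑ m ∈ sel s, γ m s ≤ z := by
      rw [hS]
      simpa only [hγ] using hs.2.2
    have hpos : 0 ≤ ∑ m ∈ sel s, γ m s :=
      Finset.sum_nonneg fun m _ => (hγ m s).symm ▸ snr_nonneg hPs hN _
    rw [Set.mem_ofPred_eq, Real.logb_le_iff_le_rpow (by norm_num) (by linarith)]
    linarith
  rw [lowerOutage_eq_orderIntegral hK hKM hφ0 hω0 hμ0 hz0, measureReal_def]
  refine (ENNReal.ofReal_le_iff_le_toReal (measure_ne_top _ _)).1 ?_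
  calc ENNReal.ofReal ((M.choose K : ℝ) * (((M - K - 1 : ℕ) : ℝ) + 1) *
        (1 / (M * μ * ω * φ + 1)) * orderIntegral K (M - K - 1) ω z)
      = ∑ i ∈ I, ENNReal.ofReal (1 / (M * μ * ω * φ + 1) * orderIntegral K (M - K - 1) ω z) := by
        rw [Finset.sum_const, nsmul_eq_mul, ← ENNReal.ofReal_natCast,
          ← ENNReal.ofReal_mul (by positivity), hcardI]
        ring_nf
    _ ≤ ∑ i ∈ I, P (B i) := Finset.sum_le_sum hB
    _ = P (⋃ i ∈ I, B i) := (measure_biUnion_finset₀ hdisj fun i _ =>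
        hvec.nullMeasurable (measurableSet_orderRegion i.1 i.2 z)).symm
    _ ≤ _ := measure_mono hsub

end FAS

end

theorem mainTheorem3
    {Ω : Type*} [MeasurableSpace Ω] (P : Measure Ω) [IsProbabilityMeasure P]
    (M K : ℕ) (hK : 1 ≤ K) (hKM : K < M)
    (Ps α N μ R : ℝ) (hPs : 0 < Ps) (hα : 0 < α) (hN : 0 < N)
    (hμ0 : 0 ≤ μ) (hμ1 : μ < 1) (hR : 0 ≤ R)
    (φ ω z : ℝ) (hφ : φ = Ps * α / N) (hω : ω = (φ * (1 - μ))⁻¹) (hz : z = 2 ^ R - 1)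
    (h₀ : Ω → ℂ) (e : Fin M → Ω → ℂ)
    (hlaw₀ : HasLaw h₀ (FAS.complexGaussian α) P)
    (hlaw : ∀ m, HasLaw (e m) (FAS.complexGaussian α) P)
    (hindep : iIndepFun (fun i : Option (Fin M) => Option.elim i h₀ e) P)
    (γ₀ : Ω → ℝ) (hγ₀ : ∀ s, γ₀ s = FAS.snr Ps N (h₀ s))
    (γ : Fin M → Ω → ℝ)
    (hγ : ∀ m s, γ m s = FAS.snr Ps N (FAS.portChannel μ (h₀ s) (e m s)))
    (sel : Ω → Finset (Fin M)) (hsel : ∀ s, FAS.IsBestPorts K (fun m => γ m s) (sel s)) :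
    -- the conditional law of each port SNR given the reference SNR
    (∀ m, ∀ᵐ x₀ ∂(P.map γ₀), condDistrib (γ m) γ₀ P x₀ =
      (volume.restrict (Set.Ioi (0 : ℝ))).withDensity
        (fun x => ENNReal.ofReal (FAS.condDensity ω μ x₀ x))) ∧
    -- its series, and the lower bound obtained by keeping the term of index zero
    (∀ x₀ x : ℝ, 0 ≤ x₀ → 0 ≤ x →
      HasSum (fun k => FAS.condDensityTerm ω μ k x₀ x) (FAS.condDensity ω μ x₀ x) ∧
      FAS.lowerDensity ω μ x₀ x = FAS.condDensityTerm ω μ 0 x₀ x ∧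
      FAS.lowerDensity ω μ x₀ x ≤ FAS.condDensity ω μ x₀ x) ∧
    -- the lower bound of the outage probability and its closed form
    FAS.lowerOutage M K φ ω μ z ≤
      P.real {s | Real.logb 2 (1 + ∑ m ∈ sel s, γ m s) ≤ R} ∧
    FAS.lowerOutage M K φ ω μ z = FAS.lowerOutageClosed M K φ ω μ z := by
  obtain rfl : γ₀ = fun s => FAS.snr Ps N (h₀ s) := funext hγ₀
  have hω0 : 0 < ω := by
    have : 0 < 1 - μ := by linarith
    rw [hω, hφ]
    positivity
  have hφ0 : 0 < φ := hφ ▸ by positivity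
  have hz0 : 0 ≤ z := by
    rw [hz, sub_nonneg]
    exact Real.one_le_rpow (by norm_num) hR
  refine ⟨fun m => ?_, fun x₀ x hx₀ hx => ⟨FAS.hasSum_condDensityTerm hμ0 hx₀ hx,
    FAS.lowerDensity_eq_term ω μ x₀ x, FAS.lowerDensity_le_condDensity hω0.le hμ0 hx₀ hx⟩,
    FAS.lowerOutage_le_outage hK hKM hPs hα hN hμ0 hμ1 hR hφ hω hz hlaw₀ hlaw hindep hγ hsel,
    FAS.lowerOutage_eq_closed hK hKM hφ0 hω0 hμ0 hz0⟩
  have hγm : γ m = fun s => FAS.snr Ps N (FAS.portChannel μ (h₀ s) (e m s)) := funext (hγ m)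
  rw [hγm]
  have hpair : IndepFun h₀ (e m) P :=
    hindep.indepFun (i := none) (j := some m) (by simp)
  exact FAS.condDistrib_snr hPs hα hN hμ0 hμ1 hφ hω hlaw₀ (hlaw m) hpair
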